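/- **Setting.** Let $N\ge 0$, $x_1<\dots<x_N$ real and $m_1,\dots,m_N>0$. Consider the boundary value problem $$D_x\Phi=\begin{pmatrix}0&\lambda m&1\\0&0&\lambda m\\1&0&0\end{pmatrix}\Phi,\qquad \Phi(-\infty)=\Phi_x(-\infty)=0,\quad \Phi_x(+\infty)=0,\qquad m=2\sum_{k=1}^N m_k\delta_{x_k},\quad z=-\lambda^2,$$ where $\Phi=(\phi_1,\phi_2,\phi_3)^T$, $\phi_3$ is continuous, and at $x_k$ the jumps are $[\phi_2]=2\lambda m_k\phi_3(x_k)$ and $[\phi_1]=2\lambda m_k\langle\phi_2\rangle(x_k)$, with $\langle\cdot\rangle$ the average of the one-sided limits. Its spectrum is the set of all $z\in\mathbb C$ for which there is a nonzero solution. Put $$S_k(z)=\begin{pmatrix}1-zm_k^2&-2zm_ke^{-x_k}&-z^2m_k^2e^{-2x_k}\\ m_ke^{x_k}&1&zm_ke^{-x_k}\\ m_k^2e^{2x_k}&2m_ke^{x_k}&1+zm_k^2\end{pmatrix},\qquad S_{[N,k]}(z)=S_N(z)S_{N-1}(z)\cdots S_{N-k+1}(z),$$ $(A_N,B_N,C_N)^T=S_{[N,N]}(z)(1,0,0)^T$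 and $W(z)=-B_N(z)/A_N(z)$ (the Weyl function). The spectral data $\{\zeta_j,b_j\}_{j=1}^N$ of the problem consist of its spectrum $\{\zeta_1,\dots,\zeta_N\}$ and the residues $b_j=\operatorname{Res}_{z=\zeta_j}W(z)$. For the measure $d\mu=\sum_{j=1}^N b_j\delta_{\zeta_j}$ let $\beta_j=\int x^j\,d\mu(x)$ and $J_{i,j}=\iint\frac{y-x}{x+y}x^iy^j\,d\mu(x)d\mu(y)$ for $i,j\in\mathbb Z$. Let $\tau_0^{(l)}=1$, $\tau_k^{(l)}=0$ for $k<0$, and for $k\ge1$ $$\tau_k^{(l)}=\operatorname{Pf}\big(J_{l+i,l+j}\big)_{i,j=0}^{k-1}\ (k\text{ even}),\qquad \tau_k^{(l)}=\operatorname{Pf}\begin{pmatrix}0&\beta_{l+j}\\-\beta_{l+i}&J_{l+i,l+j}\end{pmatrix}_{i,j=0}^{k-1}\ (k\text{ odd}),$$ and write $\tau_k=\tau_k^{(0)}$. For $1\le k\le N$ let $$Q_k(z)=\frac{-2z}{\tau_k}\operatorname{Pf}\begin{pmatrix}0&\beta_j&0\\-\beta_i&J_{i,j}&z^i\\0&-z^j&0\end{pmatrix}_{i,j=0}^{k-1}\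 (k\text{ even}),\qquad Q_k(z)=\frac{2z}{\tau_k}\operatorname{Pf}\begin{pmatrix}J_{i,j}&z^i\\-z^j&0\end{pmatrix}_{i,j=0}^{k-1}\ (k\text{ odd}),$$ $$P_k(z)=\int\frac{Q_k(z)-Q_k(x)}{z-x}\,d\mu(x)-\int\frac{Q_k(x)}{x}\,d\mu(x)+1,\qquad \hat P_k(z)=\iint\frac{Q_k(z)-Q_k(x)}{(z-x)(x+y)}\,d\mu(x)d\mu(y).$$ **Theorem.** Let $\{\zeta_k,b_k\}_{k=1}^N$ with $0<\zeta_1<\dots<\zeta_N$ and $b_k>0$ be the spectral data of the boundary value problem above, with $m_k>0$ and $x_1<\dots<x_N$. Then: 1. $\tau_k>0$ for $0\le k\le N$. 2. For $1\le k\le N$ the second column of $S_{[N,k]}(z)$ is $(-Q_k(z),\,P_k(z),\,2\hat P_k(z))^T$. 3. For $1\le k\le N$, $$m_{N-k+1}e^{-x_{N-k+1}}=\frac{\tau_{k-1}^{(1)}}{\tau_k}-\frac{\tau_{k-2}^{(1)}}{\tau_{k-1}},\qquad m_{N-k+1}e^{x_{N-k+1}}=\frac{\tau_k^{(-1)}}{\tau_{k-1}}-\frac{\tau_{k+1}^{(-1)}}{\tau_k}.$$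 4. $\{x_k,m_k\}_{k=1}^N$ is uniquely determined by the spectral data: any $x_1'<\dots<x_N'$ and $m_k'>0$ with the same spectral data satisfy $x_k'=x_k$ and $m_k'=m_k$ for all $k$. -/

import Mathlib

open Filter Topology MeasureTheory

noncomputable section

namespace NovikovPeakon

/-! ### Pfaffians -/

/-- The Pfaffian of a `2n × 2n` (skew-symmetric) matrix: the signed sum over all perfect matchings
`{i₁,i₂},…,{i₂ₙ₋₁,i₂ₙ}`, each listed with `i₂ₗ₋₁ < i₂ₗ` and `i₁ < i₃ < i₅ < ⋯`. -/
def pfaffian {n : ℕ} (A : Matrix (Fin (2 * n)) (Fin (2 * n)) ℝ) : ℝ :=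
  open Classical in
  ∑ σ : Equiv.Perm (Fin (2 * n)),
    if (∀ l : Fin n, σ ⟨2 * l, by omega⟩ < σ ⟨2 * l + 1, by omega⟩) ∧
        StrictMono (fun l : Fin n => σ ⟨2 * l, by omega⟩) then
      ((Equiv.Perm.sign σ : ℤ) : ℝ) * ∏ l : Fin n, A (σ ⟨2 * l, by omega⟩) (σ ⟨2 * l + 1, by omega⟩)
    else 0

/-- The moments `β_j = ∫ x^j dμ(x)`. -/
def moment (μ : Measure ℝ) (j : ℤ) : ℝ := ∫ x, x ^ j ∂μ

/-- The skew bimoments `J_{i,j} = ∬ (y - x)/(x + y) x^i y^j dμ(x) dμ(y)`. -/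
def skewBimoment (μ : Measure ℝ) (i j : ℤ) : ℝ :=
  ∫ x, ∫ y, (y - x) / (x + y) * x ^ i * y ^ j ∂μ ∂μ

/-- The Pfaffian `τ_k^{(l)}`: for even `k` that of `(J_{l+i,l+j})_{0 ≤ i,j ≤ k-1}`, for odd `k` that
of the same matrix bordered by a first row `(0, β_{l+j})` and a first column `(0, -β_{l+i})`;
`τ_0^{(l)} = 1`, and `τ_k^{(l)} = 0` for `k < 0`. -/
def tau (μ : Measure ℝ) (l k : ℤ) : ℝ :=
  if k < 0 then 0
  else if Even k then
    pfaffian (n := k.toNat / 2) (Matrix.of fun i j =>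
      skewBimoment μ (l + (i : ℕ)) (l + (j : ℕ)))
  else
    pfaffian (n := (k.toNat + 1) / 2) (Matrix.of fun i j =>
      if (i : ℕ) = 0 then (if (j : ℕ) = 0 then 0 else moment μ (l + (j : ℕ) - 1))
      else if (j : ℕ) = 0 then -moment μ (l + (i : ℕ) - 1)
      else skewBimoment μ (l + (i : ℕ) - 1) (l + (j : ℕ) - 1))

/-- The polynomial `Q_k(z)` in Pfaffian form. For even `k` the matrix is
`[[0, β_j, 0], [-β_i, J_{i,j}, z^i], [0, -z^j, 0]]`, for odd `k` it is
`[[J_{i,j}, z^i], [-z^j, 0]]`, where `0 ≤ i, j ≤ k - 1`. -/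
def polyQ (μ : Measure ℝ) (k : ℕ) (z : ℝ) : ℝ :=
  if Even k then
    -2 * z / tau μ 0 k *
      pfaffian (n := k / 2 + 1) (Matrix.of fun i j =>
        if (i : ℕ) = 0 then
          (if (j : ℕ) = 0 ∨ (j : ℕ) = k + 1 then 0 else moment μ ((j : ℕ) - 1))
        else if (i : ℕ) = k + 1 then
          (if (j : ℕ) = 0 ∨ (j : ℕ) = k + 1 then 0 else -z ^ ((j : ℕ) - 1))
        else if (j : ℕ) = 0 then -moment μ ((i : ℕ) - 1)
        else if (j : ℕ) = k + 1 then z ^ ((i : ℕ) - 1)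
        else skewBimoment μ ((i : ℕ) - 1) ((j : ℕ) - 1))
  else
    2 * z / tau μ 0 k *
      pfaffian (n := (k + 1) / 2) (Matrix.of fun i j =>
        if (i : ℕ) = k then (if (j : ℕ) = k then 0 else -z ^ (j : ℕ))
        else if (j : ℕ) = k then z ^ (i : ℕ)
        else skewBimoment μ (i : ℕ) (j : ℕ))

/-- `P_k(z) = ∫ (Q_k(z) - Q_k(x))/(z - x) dμ(x) - ∫ Q_k(x)/x dμ(x) + 1`. The divided difference
`dslope Q_k x z` is `(Q_k(z) - Q_k(x))/(z - x)` for `z ≠ x` and `Q_k'(x)` for `z = x`. -/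
def polyP (μ : Measure ℝ) (k : ℕ) (z : ℝ) : ℝ :=
  (∫ x, dslope (polyQ μ k) x z ∂μ) - (∫ x, polyQ μ k x / x ∂μ) + 1

/-- `P̂_k(z) = ∬ (Q_k(z) - Q_k(x))/((z - x)(x + y)) dμ(x) dμ(y)`. -/
def polyPHat (μ : Measure ℝ) (k : ℕ) (z : ℝ) : ℝ :=
  ∫ x, ∫ y, dslope (polyQ μ k) x z / (x + y) ∂μ ∂μ

/-- The discrete measure `∑ b_j δ_{ζ_j}`. -/
def spectralMeasure {N : ℕ} (ζ b : Fin N → ℝ) : Measure ℝ :=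
  ∑ j, ENNReal.ofReal (b j) • Measure.dirac (ζ j)

/-! ### The peakon boundary value problem -/

/-- The `x`-part of the Lax pair, `D_x Φ = [[0, λ𝔪, 1], [0, 0, λ𝔪], [1, 0, 0]] Φ`, for the discrete
measure `𝔪 = 2 ∑ m_k δ_{x_k}`: the equation with `𝔪 = 0` away from the `x_k`, continuity of `φ₃`,
and at `x_k` the jumps `[φ₂] = 2 λ m_k φ₃(x_k)` and `[φ₁] = 2 λ m_k ⟨φ₂⟩(x_k)`, where `⟨φ₂⟩` is the
average of the left and the right limit. -/
structure IsLaxSolution {N : ℕ} (x m : Fin N → ℝ) (lam : ℂ) (φ₁ φ₂ φ₃ : ℝ → ℂ) : Prop where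
  ode : ∀ s : ℝ, (∀ k, s ≠ x k) →
    HasDerivAt φ₁ (φ₃ s) s ∧ HasDerivAt φ₂ 0 s ∧ HasDerivAt φ₃ (φ₁ s) s
  continuous_third : Continuous φ₃
  jump : ∀ k, ∃ l₁ r₁ l₂ r₂ : ℂ,
    Tendsto φ₁ (𝓝[<] x k) (𝓝 l₁) ∧ Tendsto φ₁ (𝓝[>] x k) (𝓝 r₁) ∧
    Tendsto φ₂ (𝓝[<] x k) (𝓝 l₂) ∧ Tendsto φ₂ (𝓝[>] x k) (𝓝 r₂) ∧
    r₂ - l₂ = 2 * lam * m k * φ₃ (x k) ∧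
    r₁ - l₁ = 2 * lam * m k * ((l₂ + r₂) / 2)

/-- `z` is an eigenvalue of the boundary value problem `Φ(-∞) = Φ_x(-∞) = 0`, `Φ_x(+∞) = 0`, with
`z = -λ²`. The values of `φ₁`, `φ₂` at the points `x_k` carry no meaning, so a solution counts as
nonzero if it is nonzero at some other point. -/
def IsEigenvalue {N : ℕ} (x m : Fin N → ℝ) (z : ℂ) : Prop :=
  ∃ (lam : ℂ) (φ₁ φ₂ φ₃ : ℝ → ℂ), z = -lam ^ 2 ∧ IsLaxSolution x m lam φ₁ φ₂ φ₃ ∧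
    (∃ s : ℝ, (∀ k, s ≠ x k) ∧ (φ₁ s ≠ 0 ∨ φ₂ s ≠ 0 ∨ φ₃ s ≠ 0)) ∧
    (∀ φ ∈ ({φ₁, φ₂, φ₃} : Set (ℝ → ℂ)),
      Tendsto φ atBot (𝓝 0) ∧ Tendsto (deriv φ) atBot (𝓝 0) ∧ Tendsto (deriv φ) atTop (𝓝 0))

/-- The transition matrix `S_k(z)` of one peakon with position `x` and mass `m`. If
`Φ = (A e^s + λ² C e^{-s}, 2 λ B, A e^s - λ² C e^{-s})` on both sides of `x`, with `z = -λ²`, then it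
takes the coefficients `(A, B, C)` on the left to those on the right. -/
def transition (x m z : ℝ) : Matrix (Fin 3) (Fin 3) ℝ :=
  !![1 - z * m ^ 2, -2 * z * m * Real.exp (-x), -z ^ 2 * m ^ 2 * Real.exp (-2 * x);
     m * Real.exp x, 1, z * m * Real.exp (-x);
     m ^ 2 * Real.exp (2 * x), 2 * m * Real.exp x, 1 + z * m ^ 2]

/-- The partial transition matrix `S_{[N,k]}(z) = S_N(z) S_{N-1}(z) ⋯ S_{N-k+1}(z)`, the product of
the first `k` factors of `S_N(z) S_{N-1}(z) ⋯ S_1(z)`. -/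
def partialTransition {N : ℕ} (x m : Fin N → ℝ) (k : ℕ) (z : ℝ) : Matrix (Fin 3) (Fin 3) ℝ :=
  ((List.ofFn fun i : Fin N => transition (x i.rev) (m i.rev) z).take k).prod

/-- The coefficients `(A_N(z), B_N(z), C_N(z)) = S_N(z) ⋯ S_1(z) (1, 0, 0)` to the right of all
peakons. -/
def coeffs {N : ℕ} (x m : Fin N → ℝ) (z : ℝ) : Fin 3 → ℝ :=
  (partialTransition x m N z).mulVec ![1, 0, 0]

/-- The Weyl function `W(z) = -B_N(z) / A_N(z)`. -/
def weyl {N : ℕ} (x m : Fin N → ℝ) (z : ℝ) : ℝ := -coeffs x m z 1 / coeffs x m z 0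

/-- `{ζ_j, b_j}` is the spectral data of the boundary value problem: the `ζ_j` form its spectrum and
`b_j` is the residue of the Weyl function at `ζ_j`. -/
structure IsSpectralData {N : ℕ} (x m ζ b : Fin N → ℝ) : Prop where
  spectrum : {z : ℂ | IsEigenvalue x m z} = Set.range fun j => (ζ j : ℂ)
  residue : ∀ j, Tendsto (fun z : ℝ => (z - ζ j) * weyl x m z) (𝓝[≠] ζ j) (𝓝 (b j))

end NovikovPeakon

end

/-! Let `v = (A_N, B_N, C_N)`, let `u` be the second column of `S_{[N,k]}(z)`, and let `w` be the
coefficient vector between the `k` rightmost peakons and the others, so that `v = S_{[N,k]} w`. Two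
invariances of the transition matrices drive the argument: the pair `S(-z)`, `S(z)` preserves a
symmetric bilinear form (`pairing_polyChain`), and the suitably ordered 2×2 minors of two vectors
are transported by `S(-z)` (`minors_polyChain`).

Solving the boundary value problem between the peakons shows that `A_N` vanishes at each `ζ_j`.
Since `A_N` has degree at most `N` and `A_N(0) = 1`, these are all its zeros, and the residues `b_j`
give the partial fractions of `B_N / A_N`. Partial fractions of minors of `v` and `u` then express
`u_1` and `u_2` through `u_0` (`eval_colVec_one`, `eval_colVec_two`). The invariant form at `ζ_j`
expresses `w_1(ζ_j)` through `u_0`. As `w_1` has low degree, the residues of `z^i w_1 / A_N` add up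
to zero for `i < k`, which is `orthogonality`.

Put `u_0 = -z ∑ r_j z^j` and `S = β ⬝ r`. Orthogonality becomes `J r = -(2 - S) β`. Since `J` is
skew, `r ⬝ J r = 0`, so `S (2 - S) = 0`. The value `1 - S` of `u_1 + W u_0` at infinity has sign
`(-1)^k` (`asymp_sign`), which selects `S = 2` for odd `k` and `S = 0` for even `k`. So `r` solves a
linear system with a skew matrix, and a Pfaffian form of Cramer's rule (`pfNat_border_mul`) yields
`Q_k`, its extreme coefficients and `u_2(0)` in terms of the `τ` (`pfaffian_relations`).

The top coefficient of `Q_k` has sign `(-1)^(k-1)`, which gives `τ_k > 0` by induction. Moreover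
`r_0` and `u_2(0)` are twice the sums of `m e^{-x}` and of `m e^x` over the `k` rightmost peakons.
Differences in `k` give the formulae for one peakon; the product of the two values is `m^2`, whence
uniqueness. -/

noncomputable section

namespace NovikovPeakon

/-! ### Pfaffians as signed sums over all permutations, and their behaviour under congruence. -/

section Pfaffian

open Equiv Equiv.Perm

/-- The pairing `(l, a) ↦ 2 * l + a`. -/
def pairEquiv (n : ℕ) : Fin n × Fin 2 ≃ Fin (2 * n) where
  toFun p := ⟨2 * p.1 + p.2, by omega⟩
  invFun i := (⟨i / 2, by omega⟩, ⟨i % 2, by omega⟩)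
  left_inv := by
    rintro ⟨l, a⟩
    ext <;> simp <;> omega
  right_inv := by
    intro i
    ext
    simp
    omega

theorem pairEquiv_zero {n : ℕ} (l : Fin n) : pairEquiv n (l, 0) = ⟨2 * l, by omega⟩ := by
  simp [pairEquiv]

theorem pairEquiv_one {n : ℕ} (l : Fin n) : pairEquiv n (l, 1) = ⟨2 * l + 1, by omega⟩ := by
  simp [pairEquiv]

/-- The summand of the Pfaffian attached to a permutation. -/
def pfTerm {n : ℕ} (A : Matrix (Fin (2 * n)) (Fin (2 * n)) ℝ) (σ : Perm (Fin (2 * n))) : ℝ :=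
  ((sign σ : ℤ) : ℝ) * ∏ l : Fin n, A (σ (pairEquiv n (l, 0))) (σ (pairEquiv n (l, 1)))

/-- The permutations listing a perfect matching in increasing order. -/
def IsOrderedMatching {n : ℕ} (σ : Perm (Fin (2 * n))) : Prop :=
  (∀ l : Fin n, σ (pairEquiv n (l, 0)) < σ (pairEquiv n (l, 1))) ∧
    StrictMono (fun l : Fin n => σ (pairEquiv n (l, 0)))

open Classical in
theorem pfaffian_eq {n : ℕ} (A : Matrix (Fin (2 * n)) (Fin (2 * n)) ℝ) :
    pfaffian A = ∑ σ : Perm (Fin (2 * n)), if IsOrderedMatching σ then pfTerm A σ else 0 := by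
  simp only [pfaffian, IsOrderedMatching, pfTerm, pairEquiv_zero, pairEquiv_one]

/-- The signed sum over all permutations. -/
def fullPf {n : ℕ} (A : Matrix (Fin (2 * n)) (Fin (2 * n)) ℝ) : ℝ := ∑ σ, pfTerm A σ

/-- The permutation that permutes the pairs and flips some of them. -/
def pairPerm {n : ℕ} (h : Perm (Fin n) × (Fin n → Perm (Fin 2))) : Perm (Fin (2 * n)) :=
  (pairEquiv n).permCongr ((prodCongrLeft fun _ => h.1).trans (prodCongrRight h.2))

theorem pairPerm_apply {n : ℕ} (h : Perm (Fin n) × (Fin n → Perm (Fin 2))) (l : Fin n)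
    (a : Fin 2) :
    pairPerm h (pairEquiv n (l, a)) = pairEquiv n (h.1 l, h.2 (h.1 l) a) := by
  simp [pairPerm, Equiv.permCongr_apply]

theorem sign_pairPerm {n : ℕ} (h : Perm (Fin n) × (Fin n → Perm (Fin 2))) :
    sign (pairPerm h) = ∏ l, sign (h.2 l) := by
  have h1 : ((prodCongrLeft fun _ => h.1).trans (prodCongrRight h.2) : Perm (Fin n × Fin 2)) =
    prodCongrRight h.2 * prodCongrLeft fun _ => h.1 := rfl
  rw [pairPerm, sign_permCongr, h1, Perm.sign_mul, sign_prodCongrRight, sign_prodCongrLeft]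
  simp

theorem perm_fin_two (f : Perm (Fin 2)) : f = 1 ∨ f = swap 0 1 := by
  revert f; decide

theorem skew_pair_perm {α : Type*} (A : α → α → ℝ) (hA : ∀ i j, A j i = -A i j) (g : Fin 2 → α)
    (f : Perm (Fin 2)) :
    A (g (f 0)) (g (f 1)) = ((sign f : ℤ) : ℝ) * A (g 0) (g 1) := by
  rcases perm_fin_two f with rfl | rfl
  · simp
  · simp [hA (g 0) (g 1)]

/-- Permuting the pairs is an even permutation and only reorders the product; flipping a pair
changes the sign of the permutation and, by skewness, the sign of one factor. -/
theorem pfTerm_mul_pairPerm {n : ℕ} (A : Matrix (Fin (2 * n)) (Fin (2 * n)) ℝ)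
    (hA : ∀ i j, A j i = -A i j) (σ : Perm (Fin (2 * n)))
    (h : Perm (Fin n) × (Fin n → Perm (Fin 2))) :
    pfTerm A (σ * pairPerm h) = pfTerm A σ := by
  have h1 : ∏ l : Fin n, A (σ (pairEquiv n (h.1 l, h.2 (h.1 l) 0)))
        (σ (pairEquiv n (h.1 l, h.2 (h.1 l) 1))) =
      ∏ l : Fin n, A (σ (pairEquiv n (l, h.2 l 0))) (σ (pairEquiv n (l, h.2 l 1))) :=
    Equiv.prod_comp h.1 fun l => A (σ (pairEquiv n (l, h.2 l 0))) (σ (pairEquiv n (l, h.2 l 1)))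
  have h2 : ∀ l, A (σ (pairEquiv n (l, h.2 l 0))) (σ (pairEquiv n (l, h.2 l 1))) =
      ((sign (h.2 l) : ℤ) : ℝ) * A (σ (pairEquiv n (l, 0))) (σ (pairEquiv n (l, 1))) := fun l =>
    skew_pair_perm A hA (fun a => σ (pairEquiv n (l, a))) (h.2 l)
  have h3 : (∏ l, ((sign (h.2 l) : ℤ) : ℝ)) * ∏ l, ((sign (h.2 l) : ℤ) : ℝ) = 1 := by
    rw [← Finset.prod_mul_distrib]
    refine Finset.prod_eq_one fun l _ => ?_
    rw [← Int.cast_mul, ← Units.val_mul, Int.units_mul_self]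
    simp
  simp only [pfTerm, Perm.mul_apply, pairPerm_apply, Perm.sign_mul, sign_pairPerm, h1]
  simp only [h2, Finset.prod_mul_distrib]
  push_cast
  linear_combination ((sign σ : ℤ) : ℝ) *
    (∏ l, A (σ (pairEquiv n (l, 0))) (σ (pairEquiv n (l, 1)))) * h3

/-- Each pair has exactly one increasing orientation, and the smaller elements, being distinct, can
be sorted in exactly one way. So every coset of the pair-preserving permutations contains one
ordered matching. -/
theorem existsUnique_isOrderedMatching_mul {n : ℕ} (σ : Perm (Fin (2 * n))) :
    ∃! h : Perm (Fin n) × (Fin n → Perm (Fin 2)), IsOrderedMatching (σ * pairPerm h) := by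
  classical
  have key : ∀ l : Fin n, ∃! f : Perm (Fin 2),
      σ (pairEquiv n (l, f 0)) < σ (pairEquiv n (l, f 1)) := by
    intro l
    have hne : σ (pairEquiv n (l, 0)) ≠ σ (pairEquiv n (l, 1)) := by simp
    rcases lt_or_gt_of_ne hne with h | h
    · refine ⟨1, by simpa using h, fun f hf => ?_⟩
      rcases perm_fin_two f with rfl | rfl
      · rfl
      · simp at hf
        exact absurd h hf.not_gt
    · refine ⟨swap 0 1, by simpa using h, fun f hf => ?_⟩
      rcases perm_fin_two f with rfl | rfl
      · simp at hf
        exact absurd h hf.not_gt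
      · rfl
  choose f hf huniq using key
  set g : Fin n → Fin (2 * n) := fun l => σ (pairEquiv n (l, f l 0)) with hg
  have ginj : Function.Injective g := by
    intro l l' h
    simpa using congrArg Prod.fst ((pairEquiv n).injective (σ.injective h))
  refine ⟨(Tuple.sort g, f), ⟨fun l => ?_, ?_⟩, ?_⟩
  · simpa only [Perm.mul_apply, pairPerm_apply] using hf _
  · have := (Tuple.monotone_sort g).strictMono_of_injective (ginj.comp (Tuple.sort g).injective)
    simp only [Perm.mul_apply, pairPerm_apply]
    exact this
  · rintro ⟨π, f'⟩ ⟨h1, h2⟩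
    simp only [Perm.mul_apply, pairPerm_apply] at h1 h2
    have hff : f' = f := by
      funext l
      have := h1 (π.symm l)
      rw [Equiv.apply_symm_apply] at this
      exact huniq l _ this
    subst hff
    have h3 : g ∘ π = g ∘ Tuple.sort g :=
      Tuple.unique_monotone h2.monotone (Tuple.monotone_sort g)
    have : π = Tuple.sort g := by
      ext1 l
      exact ginj (congrFun h3 l)
    rw [this]

/-- The sum over all permutations counts every matching equally often. It is easier to transform
than the sum over ordered matchings, and the factor cancels in identities between Pfaffians of one
size. -/
theorem card_mul_pfaffian {n : ℕ} (A : Matrix (Fin (2 * n)) (Fin (2 * n)) ℝ)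
    (hA : ∀ i j, A j i = -A i j) :
    (Fintype.card (Perm (Fin n) × (Fin n → Perm (Fin 2))) : ℝ) * pfaffian A = fullPf A := by
  classical
  have h1 : ∀ h : Perm (Fin n) × (Fin n → Perm (Fin 2)),
      pfaffian A = ∑ σ, if IsOrderedMatching (σ * pairPerm h) then pfTerm A σ else 0 := by
    intro h
    rw [pfaffian_eq, ← Equiv.sum_comp (Equiv.mulRight (pairPerm h))]
    refine Finset.sum_congr rfl fun σ _ => ?_
    simp only [Equiv.coe_mulRight, pfTerm_mul_pairPerm A hA]
  have h2 : ∑ _h : Perm (Fin n) × (Fin n → Perm (Fin 2)), pfaffian A = fullPf A := by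
    rw [Finset.sum_congr rfl fun h _ => h1 h, Finset.sum_comm]
    refine Finset.sum_congr rfl fun σ _ => ?_
    obtain ⟨h, hh, huniq⟩ := existsUnique_isOrderedMatching_mul σ
    rw [Finset.sum_eq_single h]
    · rw [if_pos hh]
    · intro h' _ hne
      exact if_neg fun hc => hne (huniq h' hc)
    · simp
  rw [← h2]
  simp

theorem fullPf_submatrix {n : ℕ} (A : Matrix (Fin (2 * n)) (Fin (2 * n)) ℝ)
    (τ : Perm (Fin (2 * n))) :
    fullPf (A.submatrix τ τ) = ((sign τ : ℤ) : ℝ) * fullPf A := by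
  rw [fullPf, fullPf, Finset.mul_sum]
  refine Fintype.sum_equiv (Equiv.mulLeft τ) _ _ fun σ => ?_
  simp only [pfTerm, Matrix.submatrix_apply, Equiv.coe_mulLeft, Perm.mul_apply, Perm.sign_mul]
  have : ((sign τ : ℤ) : ℝ) * ((sign τ : ℤ) : ℝ) = 1 := by
    rw [← Int.cast_mul, ← Units.val_mul, Int.units_mul_self]
    simp
  push_cast
  linear_combination (-((sign σ : ℤ) : ℝ) *
    ∏ l, A (τ (σ (pairEquiv n (l, 0)))) (τ (σ (pairEquiv n (l, 1))))) * this

/-- A map on `Fin (2 * n)` as a family of pairs of values. -/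
def pairFun (n : ℕ) (α : Type*) : (Fin n → α × α) ≃ (Fin (2 * n) → α) where
  toFun p i := if ((pairEquiv n).symm i).2 = 0 then (p ((pairEquiv n).symm i).1).1
    else (p ((pairEquiv n).symm i).1).2
  invFun q l := (q (pairEquiv n (l, 0)), q (pairEquiv n (l, 1)))
  left_inv p := by
    funext l
    simp
  right_inv q := by
    funext i
    obtain ⟨⟨l, a⟩, rfl⟩ := (pairEquiv n).surjective i
    fin_cases a <;> simp

theorem prod_pairEquiv {n : ℕ} (g : Fin (2 * n) → ℝ) :
    ∏ i, g i = ∏ l : Fin n, g (pairEquiv n (l, 0)) * g (pairEquiv n (l, 1)) := by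
  rw [← Equiv.prod_comp (pairEquiv n), Fintype.prod_prod_type]
  simp

/-- Expanding the entries of `B * A * Bᵀ` and summing over the permutation first leaves determinants
of column selections of `B`. A selection with a repeated column contributes nothing, so only
permutations of the columns survive. -/
theorem fullPf_congruence {n : ℕ} (A B : Matrix (Fin (2 * n)) (Fin (2 * n)) ℝ) :
    fullPf (B * A * B.transpose) = B.det * fullPf A := by
  classical
  have h1 : ∀ σ : Perm (Fin (2 * n)), pfTerm (B * A * B.transpose) σ =
      ∑ q : Fin (2 * n) → Fin (2 * n),
        (∏ l, A (q (pairEquiv n (l, 0))) (q (pairEquiv n (l, 1)))) *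
          (((sign σ : ℤ) : ℝ) * ∏ i, B (σ i) (q i)) := by
    intro σ
    have : ∀ l : Fin n, (B * A * B.transpose) (σ (pairEquiv n (l, 0))) (σ (pairEquiv n (l, 1))) =
        ∑ p : Fin (2 * n) × Fin (2 * n), A p.1 p.2 *
          (B (σ (pairEquiv n (l, 0))) p.1 * B (σ (pairEquiv n (l, 1))) p.2) := by
      intro l
      rw [Fintype.sum_prod_type, Finset.sum_comm]
      simp only [Matrix.mul_apply, Matrix.transpose_apply, Finset.sum_mul]
      refine Finset.sum_congr rfl fun _ _ => Finset.sum_congr rfl fun _ _ => by ring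
    simp only [pfTerm, this]
    rw [Finset.prod_univ_sum, Fintype.piFinset_univ, Finset.mul_sum]
    refine Fintype.sum_equiv (pairFun n _) _ _ fun p => ?_
    rw [prod_pairEquiv]
    have e0 : ∀ l, pairFun n _ p (pairEquiv n (l, 0)) = (p l).1 := by simp [pairFun]
    have e1 : ∀ l, pairFun n _ p (pairEquiv n (l, 1)) = (p l).2 := by simp [pairFun]
    simp only [e0, e1, Finset.prod_mul_distrib]
    ring
  have h2 : ∀ q : Fin (2 * n) → Fin (2 * n),
      ∑ σ : Perm (Fin (2 * n)), ((sign σ : ℤ) : ℝ) * ∏ i, B (σ i) (q i) =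
        (B.submatrix id q).det := by
    intro q
    rw [Matrix.det_apply']
    rfl
  calc fullPf (B * A * B.transpose)
      = ∑ q : Fin (2 * n) → Fin (2 * n),
        (∏ l, A (q (pairEquiv n (l, 0))) (q (pairEquiv n (l, 1)))) * (B.submatrix id q).det := by
        rw [fullPf, Finset.sum_congr rfl fun σ _ => h1 σ, Finset.sum_comm]
        simp only [← Finset.mul_sum, h2]
    _ = ∑ q : Fin (2 * n) → Fin (2 * n) with q.Bijective,
        (∏ l, A (q (pairEquiv n (l, 0))) (q (pairEquiv n (l, 1)))) * (B.submatrix id q).det := by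
        refine (Finset.sum_subset (Finset.filter_subset _ _) fun q _ hq => ?_).symm
        rw [Finset.mem_filter_univ, ← Finite.injective_iff_bijective, Function.Injective] at hq
        push Not at hq
        obtain ⟨i, j, hij, hne⟩ := hq
        rw [Matrix.det_zero_of_column_eq hne fun k => by simp [hij], mul_zero]
    _ = ∑ τ : Perm (Fin (2 * n)),
        (∏ l, A (τ (pairEquiv n (l, 0))) (τ (pairEquiv n (l, 1)))) * (B.submatrix id τ).det :=
        Finset.sum_bij (fun q h => Equiv.ofBijective q (Finset.mem_filter.1 h).2)
          (fun _ _ => Finset.mem_univ _) (fun _ _ _ _ h => by injection h)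
          (fun b _ => ⟨b, Finset.mem_filter.2 ⟨Finset.mem_univ _, b.bijective⟩,
            DFunLike.coe_injective rfl⟩) fun _ _ => rfl
    _ = B.det * fullPf A := by
        simp only [Matrix.det_permute', fullPf, pfTerm, Finset.mul_sum]
        refine Finset.sum_congr rfl fun τ _ => by ring

end Pfaffian

/-! ### Bordered Pfaffians: a Cramer rule for skew systems and expansion along a unit column. -/

section PfaffianBorder

open Equiv Equiv.Perm

/-- If the row `j` of two matrices vanishes off the column `t` and the matrices agree off `j` and
`t`, then their signed sums are proportional to the entries at `(j, t)`. -/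
theorem fullPf_mul_entry {n : ℕ} (X Y : Matrix (Fin (2 * n)) (Fin (2 * n)) ℝ) (j t : Fin (2 * n))
    (hX : ∀ i, i ≠ t → X j i = 0 ∧ X i j = 0) (hY : ∀ i, i ≠ t → Y j i = 0 ∧ Y i j = 0)
    (hXs : X t j = -X j t) (hYs : Y t j = -Y j t)
    (hXY : ∀ a b, a ≠ j → b ≠ j → a ≠ t → b ≠ t → X a b = Y a b) :
    fullPf X * Y j t = fullPf Y * X j t := by
  rw [fullPf, fullPf, Finset.sum_mul, Finset.sum_mul]
  refine Finset.sum_congr rfl fun σ _ => ?_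
  obtain ⟨p, hp⟩ := (pairEquiv n).surjective (σ.symm j)
  obtain ⟨l₀, a⟩ := p
  have hj : σ (pairEquiv n (l₀, a)) = j := by rw [hp, Equiv.apply_symm_apply]
  have hinj : ∀ q r, σ (pairEquiv n q) = σ (pairEquiv n r) ↔ q = r := by simp
  simp only [pfTerm]
  rw [← Finset.mul_prod_erase Finset.univ _ (Finset.mem_univ l₀),
    ← Finset.mul_prod_erase Finset.univ
      (fun l => Y (σ (pairEquiv n (l, 0))) (σ (pairEquiv n (l, 1)))) (Finset.mem_univ l₀)]
  -- The identity holds term by term: unless `σ` pairs `j` with `t`, both terms vanish; if it does,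
  -- the remaining factors avoid `j` and `t` and agree.
  have hrest : σ (pairEquiv n (l₀, 1 - a)) = t →
      ∏ l ∈ Finset.univ.erase l₀, X (σ (pairEquiv n (l, 0))) (σ (pairEquiv n (l, 1))) =
      ∏ l ∈ Finset.univ.erase l₀, Y (σ (pairEquiv n (l, 0))) (σ (pairEquiv n (l, 1))) := by
    intro ht
    refine Finset.prod_congr rfl fun l hl => ?_
    have hl' := Finset.ne_of_mem_erase hl
    have hne : ∀ b c, σ (pairEquiv n (l, b)) ≠ σ (pairEquiv n (l₀, c)) := fun b c h => by
      have := (hinj _ _).1 h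
      simp [hl'] at this
    exact hXY _ _ (hj ▸ hne _ _) (hj ▸ hne _ _) (ht ▸ hne _ _) (ht ▸ hne _ _)
  fin_cases a
  · by_cases ht : σ (pairEquiv n (l₀, 1)) = t
    · rw [hrest ht]
      simp only [Fin.zero_eta] at hj
      rw [hj, ht]
      ring
    · simp only [Fin.zero_eta] at hj
      rw [hj, (hX _ ht).1, (hY _ ht).1]
      ring
  · by_cases ht : σ (pairEquiv n (l₀, 0)) = t
    · rw [hrest ht]
      simp only [Fin.mk_one] at hj
      rw [hj, ht, hXs, hYs]
      ring
    · simp only [Fin.mk_one] at hj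
      rw [hj, (hX _ ht).2, (hY _ ht).2]
      ring

-- A congruence by the identity matrix with row `j` replaced by `v`, where `v j ≠ 0`, turns row `j`
-- of each matrix into its product with `v`, which vanishes off `t`. Then `fullPf_mul_entry`
-- applies, and the common determinant `v j` cancels.
open Matrix in
theorem fullPf_mul_of_kernel {n : ℕ} (G H : Matrix (Fin (2 * n)) (Fin (2 * n)) ℝ)
    (hG : ∀ i j, G j i = -G i j) (hH : ∀ i j, H j i = -H i j) (t : Fin (2 * n))
    (v : Fin (2 * n) → ℝ) (hvt : v t = 0)
    (hGv : ∀ i, i ≠ t → (G *ᵥ v) i = 0) (hHv : ∀ i, i ≠ t → (H *ᵥ v) i = 0)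
    (hGH : ∀ a b, a ≠ t → b ≠ t → G a b = H a b) :
    fullPf G * (H *ᵥ v) t = fullPf H * (G *ᵥ v) t := by
  by_cases hv : v = 0
  · simp [hv]
  obtain ⟨j, hj⟩ := Function.ne_iff.1 hv
  have hj : v j ≠ 0 := hj
  have hjt : j ≠ t := fun h => hj (h ▸ hvt)
  set B : Matrix (Fin (2 * n)) (Fin (2 * n)) ℝ := (1 : Matrix _ _ ℝ).updateRow j v with hB
  have hdet : B.det = v j := by
    have := Matrix.det_updateRow_sum (1 : Matrix (Fin (2 * n)) (Fin (2 * n)) ℝ) j v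
    rw [Matrix.det_one, smul_eq_mul, mul_one] at this
    rw [← this, hB]
    congr 2
    ext k
    simp [Matrix.one_apply]
  have hsk : ∀ A : Matrix (Fin (2 * n)) (Fin (2 * n)) ℝ, (∀ i j, A j i = -A i j) →
      ∀ a b, (B * A * Bᵀ) b a = -(B * A * Bᵀ) a b := by
    intro A hA a b
    have hA' : Aᵀ = -A := by
      ext a b
      simp [hA a b]
    have : (B * A * Bᵀ)ᵀ = -(B * A * Bᵀ) := by
      rw [Matrix.transpose_mul, Matrix.transpose_mul, hA']
      simp [Matrix.mul_assoc]
    exact congrFun (congrFun this a) b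
  have hcol : ∀ (A : Matrix (Fin (2 * n)) (Fin (2 * n)) ℝ), ∀ a, a ≠ j →
      (B * A * Bᵀ) a j = (A *ᵥ v) a := by
    intro A a ha
    rw [Matrix.mul_apply, Matrix.mulVec, dotProduct]
    refine Finset.sum_congr rfl fun c _ => ?_
    rw [Matrix.mul_apply, hB, Matrix.transpose_apply, Matrix.updateRow_self]
    congr 1
    simp [Matrix.updateRow_ne ha, Matrix.one_apply]
  have hother : ∀ (A : Matrix (Fin (2 * n)) (Fin (2 * n)) ℝ), ∀ a b, a ≠ j → b ≠ j →
      (B * A * Bᵀ) a b = A a b := by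
    intro A a b ha hb
    simp [Matrix.mul_apply, hB, Matrix.transpose_apply, Matrix.updateRow_ne ha,
      Matrix.updateRow_ne hb, Matrix.one_apply]
  have hdiag : ∀ A : Matrix (Fin (2 * n)) (Fin (2 * n)) ℝ, (∀ i j, A j i = -A i j) →
      (B * A * Bᵀ) j j = 0 := fun A hA => by
    have := hsk A hA j j
    linarith
  have hrow : ∀ A : Matrix (Fin (2 * n)) (Fin (2 * n)) ℝ, (∀ i j, A j i = -A i j) →
      (∀ i, i ≠ t → (A *ᵥ v) i = 0) →
      ∀ i, i ≠ t → (B * A * Bᵀ) j i = 0 ∧ (B * A * Bᵀ) i j = 0 := by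
    intro A hA hAv i hi
    by_cases hij : i = j
    · rw [hij]
      exact ⟨hdiag A hA, hdiag A hA⟩
    · have h1 := hcol A i hij
      rw [hAv i hi] at h1
      exact ⟨by rw [hsk A hA i j, h1, neg_zero], h1⟩
  have hmain := fullPf_mul_entry (B * G * Bᵀ) (B * H * Bᵀ) j t (hrow G hG hGv) (hrow H hH hHv)
    (hsk G hG j t) (hsk H hH j t) fun a b ha hb hat hbt => by
      rw [hother G a b ha hb, hother H a b ha hb, hGH a b hat hbt]
  rw [fullPf_congruence, fullPf_congruence, hdet, hsk H hH t j, hsk G hG t j,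
    hcol H t hjt.symm, hcol G t hjt.symm] at hmain
  have : v j * (fullPf G * (H *ᵥ v) t - fullPf H * (G *ᵥ v) t) = 0 := by linarith
  rcases mul_eq_zero.1 this with h | h
  · exact absurd h hj
  · linarith

/-- The Pfaffian of the leading `2n × 2n` block of an infinite array. -/
def pfNat (n : ℕ) (M : ℕ → ℕ → ℝ) : ℝ :=
  pfaffian (n := n) (Matrix.of fun i j => M i j)

/-- Skew-symmetry of an infinite array. -/
def SkewArray (M : ℕ → ℕ → ℝ) : Prop := ∀ i j, M j i = -M i j

theorem pfNat_congr {n : ℕ} {M M' : ℕ → ℕ → ℝ}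
    (h : ∀ i < 2 * n, ∀ j < 2 * n, M i j = M' i j) : pfNat n M = pfNat n M' := by
  unfold pfNat
  congr 1
  ext i j
  exact h i i.2 j j.2

theorem card_pairs_ne_zero (n : ℕ) :
    (Fintype.card (Perm (Fin n) × (Fin n → Perm (Fin 2))) : ℝ) ≠ 0 := by
  exact_mod_cast Fintype.card_ne_zero

theorem card_mul_pfNat {n : ℕ} {M : ℕ → ℕ → ℝ} (hM : SkewArray M) :
    (Fintype.card (Perm (Fin n) × (Fin n → Perm (Fin 2))) : ℝ) * pfNat n M =
      fullPf (n := n) (Matrix.of fun i j => M i j) :=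
  card_mul_pfaffian _ fun i j => hM i j

theorem pfNat_perm {n : ℕ} {M M' : ℕ → ℕ → ℝ} (hM : SkewArray M) (σ : Perm (Fin (2 * n)))
    (h : ∀ i j : Fin (2 * n), M' i j = M (σ i) (σ j)) :
    pfNat n M' = ((sign σ : ℤ) : ℝ) * pfNat n M := by
  have h1 : (Matrix.of fun i j : Fin (2 * n) => M' i j) =
      (Matrix.of fun i j : Fin (2 * n) => M i j).submatrix σ σ := by
    ext i j
    simp [h]
  have h2 := fullPf_submatrix (Matrix.of fun i j : Fin (2 * n) => M i j) σ
  rw [← card_mul_pfNat hM, ← card_mul_pfaffian ((Matrix.of fun i j : Fin (2 * n) => M i j).submatrix σ σ)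
    fun i j => hM _ _] at h2
  refine mul_left_cancel₀ (card_pairs_ne_zero n) ?_
  rw [pfNat, h1, h2]
  ring

theorem pfNat_scale {n : ℕ} (M : ℕ → ℕ → ℝ) (s : ℕ → ℝ) :
    pfNat n (fun i j => s i * s j * M i j) = (∏ i : Fin (2 * n), s i) * pfNat n M := by
  classical
  simp only [pfNat, pfaffian_eq, Finset.mul_sum]
  refine Finset.sum_congr rfl fun σ _ => ?_
  split_ifs
  · rw [← Equiv.prod_comp σ, prod_pairEquiv]
    simp only [pfTerm, Matrix.of_apply, Finset.prod_mul_distrib]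
    ring
  · simp

/-- The array `M` on indices below `d`, bordered by a last column `w` and a last row `-w`. -/
def border (M : ℕ → ℕ → ℝ) (w : ℕ → ℝ) (d i j : ℕ) : ℝ :=
  if i = d then (if j = d then 0 else -w j) else if j = d then w i else M i j

/-- The array `M` bordered by a first row `w` and a first column `-w`. -/
def borderFirst (M : ℕ → ℕ → ℝ) (w : ℕ → ℝ) (i j : ℕ) : ℝ :=
  if i = 0 then (if j = 0 then 0 else w (j - 1)) else if j = 0 then -w (i - 1)
  else M (i - 1) (j - 1)

theorem SkewArray.border {M : ℕ → ℕ → ℝ} (hM : SkewArray M) (w : ℕ → ℝ) (d : ℕ) :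
    SkewArray (border M w d) := by
  intro i j
  unfold NovikovPeakon.border
  have := hM i j
  split_ifs <;> simp [this]

theorem SkewArray.borderFirst {M : ℕ → ℕ → ℝ} (hM : SkewArray M) (w : ℕ → ℝ) :
    SkewArray (borderFirst M w) := by
  intro i j
  unfold NovikovPeakon.borderFirst
  have := hM (i - 1) (j - 1)
  split_ifs <;> simp [this]

/-- For a vector `v` in the kernel of a skew-symmetric array of odd size, the Pfaffian of the
array bordered by `w` is proportional to `v ⬝ w`. -/
theorem pfNat_border_mul {n : ℕ} {M : ℕ → ℕ → ℝ} (hM : SkewArray M) (v w w' : ℕ → ℝ)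
    (hv : ∀ i < 2 * n + 1, ∑ j ∈ Finset.range (2 * n + 1), M i j * v j = 0) :
    pfNat (n + 1) (border M w (2 * n + 1)) * ∑ j ∈ Finset.range (2 * n + 1), v j * w' j =
      pfNat (n + 1) (border M w' (2 * n + 1)) * ∑ j ∈ Finset.range (2 * n + 1), v j * w j := by
  set t : Fin (2 * (n + 1)) := ⟨2 * n + 1, by omega⟩ with ht
  -- Extended by zero, `v` is annihilated by every row of the bordered array except the border row,
  -- where it gives `-(v ⬝ w)`.
  set v' : Fin (2 * (n + 1)) → ℝ := fun i => if i = t then 0 else v i with hv'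
  have hsum : ∀ (u : ℕ → ℝ), ∑ j : Fin (2 * (n + 1)), u j * v' j =
      ∑ j ∈ Finset.range (2 * n + 1), u j * v j := by
    intro u
    have h1 : ∀ j : Fin (2 * (n + 1)),
        u j * v' j = (fun k : ℕ => if k = 2 * n + 1 then 0 else u k * v k) j := by
      intro j
      simp only [hv', ht, Fin.ext_iff]
      split_ifs <;> simp
    rw [Finset.sum_congr rfl fun j _ => h1 j,
      Fin.sum_univ_eq_sum_range (fun k : ℕ => if k = 2 * n + 1 then 0 else u k * v k)]
    rw [show 2 * (n + 1) = 2 * n + 1 + 1 by ring, Finset.sum_range_succ, if_pos rfl, add_zero]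
    refine Finset.sum_congr rfl fun j hj => ?_
    rw [if_neg (Finset.mem_range.1 hj).ne]
  have hmv : ∀ (w : ℕ → ℝ) (i : Fin (2 * (n + 1))),
      ((Matrix.of fun i j : Fin (2 * (n + 1)) => border M w (2 * n + 1) i j).mulVec v') i =
        if i = t then -∑ j ∈ Finset.range (2 * n + 1), v j * w j else 0 := by
    intro w i
    have : ((Matrix.of fun i j : Fin (2 * (n + 1)) => border M w (2 * n + 1) i j).mulVec v') i =
        ∑ j : Fin (2 * (n + 1)), border M w (2 * n + 1) i j * v' j := rfl
    rw [this, hsum]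
    split_ifs with hi
    · rw [← Finset.sum_neg_distrib]
      refine Finset.sum_congr rfl fun j hj => ?_
      have := (Finset.mem_range.1 hj).ne
      simp only [border, hi, ht, this, if_true, if_false]
      ring
    · have hi' : (i : ℕ) ≠ 2 * n + 1 := fun h => hi (Fin.ext h)
      rw [← hv i (by omega)]
      refine Finset.sum_congr rfl fun j hj => ?_
      have := (Finset.mem_range.1 hj).ne
      simp [border, hi', this]
  have hmain := fullPf_mul_of_kernel
    (Matrix.of fun i j : Fin (2 * (n + 1)) => border M w (2 * n + 1) i j)
    (Matrix.of fun i j : Fin (2 * (n + 1)) => border M w' (2 * n + 1) i j)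
    (fun i j => hM.border w _ _ _) (fun i j => hM.border w' _ _ _) t v' (by simp [hv'])
    (fun i hi => by rw [hmv, if_neg hi]) (fun i hi => by rw [hmv, if_neg hi])
    (fun a b ha hb => by
      have ha' : (a : ℕ) ≠ 2 * n + 1 := fun h => ha (Fin.ext h)
      have hb' : (b : ℕ) ≠ 2 * n + 1 := fun h => hb (Fin.ext h)
      simp [border, ha', hb'])
  rw [hmv, hmv, if_pos rfl, if_pos rfl,
    ← card_mul_pfNat (hM.border w _), ← card_mul_pfNat (hM.border w' _)] at hmain
  refine mul_left_cancel₀ (card_pairs_ne_zero (n + 1)) ?_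
  linarith

/-- The extension of a permutation by the identity on two further points. -/
def extendPerm {n : ℕ} (ρ : Perm (Fin (2 * n))) : Perm (Fin (2 * (n + 1))) :=
  (finSumFinEquiv (m := 2 * n) (n := 2)).permCongr (Perm.sumCongr ρ 1)

theorem extendPerm_castSucc {n : ℕ} (ρ : Perm (Fin (2 * n))) (l : Fin n) (a : Fin 2) :
    extendPerm ρ (pairEquiv (n + 1) (l.castSucc, a)) =
      Fin.castAdd 2 (ρ (pairEquiv n (l, a))) := by
  have : pairEquiv (n + 1) (l.castSucc, a) =
      finSumFinEquiv (m := 2 * n) (n := 2) (Sum.inl (pairEquiv n (l, a))) := by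
    ext
    simp [pairEquiv]
  rw [this, extendPerm, Equiv.permCongr_apply, Equiv.symm_apply_apply]
  rfl

theorem extendPerm_last {n : ℕ} (ρ : Perm (Fin (2 * n))) (a : Fin 2) :
    extendPerm ρ (pairEquiv (n + 1) (Fin.last n, a)) = Fin.natAdd (2 * n) a := by
  have : pairEquiv (n + 1) (Fin.last n, a) =
      finSumFinEquiv (m := 2 * n) (n := 2) (Sum.inr a) := by
    ext
    simp [pairEquiv]
  rw [this, extendPerm, Equiv.permCongr_apply, Equiv.symm_apply_apply]
  rfl

theorem isOrderedMatching_extendPerm {n : ℕ} (ρ : Perm (Fin (2 * n))) :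
    IsOrderedMatching (extendPerm ρ) ↔ IsOrderedMatching ρ := by
  constructor
  · rintro ⟨h1, h2⟩
    refine ⟨fun l => ?_, fun l l' hl => ?_⟩
    · have := h1 l.castSucc
      rwa [extendPerm_castSucc, extendPerm_castSucc] at this
    · have := @h2 l.castSucc l'.castSucc hl
      simp only at this
      rwa [extendPerm_castSucc, extendPerm_castSucc] at this
  · rintro ⟨h1, h2⟩
    refine ⟨fun l => ?_, fun l l' hl => ?_⟩
    · refine Fin.lastCases ?_ (fun l => ?_) l
      · rw [extendPerm_last, extendPerm_last]
        exact Fin.mk_lt_mk.2 (by simp)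
      · rw [extendPerm_castSucc, extendPerm_castSucc]
        exact h1 l
    · induction l using Fin.lastCases with
      | last => exact absurd hl (Fin.le_last _).not_gt
      | cast l =>
        induction l' using Fin.lastCases with
        | last =>
          simp only
          rw [extendPerm_castSucc, extendPerm_last]
          exact Fin.mk_lt_mk.2 (by simp)
        | cast l' =>
          simp only
          rw [extendPerm_castSucc, extendPerm_castSucc]
          exact h2 hl

theorem sign_extendPerm {n : ℕ} (ρ : Perm (Fin (2 * n))) : sign (extendPerm ρ) = sign ρ := by
  rw [extendPerm, sign_permCongr, Perm.sign_sumCongr, Perm.sign_one, mul_one]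

theorem extendPerm_injective {n : ℕ} : Function.Injective (extendPerm (n := n)) := by
  intro ρ ρ' h
  have := (finSumFinEquiv (m := 2 * n) (n := 2)).permCongr.injective h
  ext i
  have h2 := congrArg (fun f : Perm (Fin (2 * n) ⊕ Fin 2) => f (Sum.inl i)) this
  simp at h2
  rw [h2]

theorem exists_extendPerm {n : ℕ} (σ : Perm (Fin (2 * (n + 1))))
    (h : ∀ a : Fin 2, σ (Fin.natAdd (2 * n) a) = Fin.natAdd (2 * n) a) :
    ∃ ρ, extendPerm ρ = σ := by
  set e := finSumFinEquiv (m := 2 * n) (n := 2) with he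
  set τ : Perm (Fin (2 * n) ⊕ Fin 2) := e.symm.permCongr σ with hτ
  have hinr : ∀ a : Fin 2, τ (Sum.inr a) = Sum.inr a := by
    intro a
    rw [hτ, Equiv.permCongr_apply, Equiv.symm_symm]
    have h2 : e (Sum.inr a) = Fin.natAdd (2 * n) a := by simp [he]
    have h3 : σ (e (Sum.inr a)) = e (Sum.inr a) := by
      rw [h2]
      exact h a
    exact (congrArg e.symm h3).trans (e.symm_apply_apply _)
  have hmaps : Set.MapsTo τ (Set.range Sum.inl) (Set.range Sum.inl) := by
    rintro _ ⟨i, rfl⟩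
    rcases hx : τ (Sum.inl i) with k | a
    · exact ⟨k, rfl⟩
    · rw [← hinr a] at hx
      exact absurd (τ.injective hx) (by simp)
  obtain ⟨⟨ρ, θ⟩, hρ⟩ := mem_sumCongrHom_range_of_perm_mapsTo_inl hmaps
  have hθ : θ = 1 := by
    ext1 a
    have := hinr a
    rw [← hρ] at this
    simpa using this
  refine ⟨ρ, ?_⟩
  rw [hθ] at hρ
  have hρ' : Perm.sumCongr ρ 1 = τ := hρ
  rw [extendPerm, hρ', hτ, ← he]
  ext1 i
  simp only [Equiv.permCongr_apply, Equiv.symm_symm, Equiv.apply_symm_apply]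

/-- Expansion along a last column that is the next-to-last unit vector. -/
theorem pfNat_border_unit {n : ℕ} (M : ℕ → ℕ → ℝ) (w : ℕ → ℝ) (h1 : w (2 * n) = 1)
    (h0 : ∀ i < 2 * n, w i = 0) :
    pfNat (n + 1) (border M w (2 * n + 1)) = pfNat n M := by
  classical
  rw [pfNat, pfNat, pfaffian_eq, pfaffian_eq]
  symm
  refine Finset.sum_of_injOn extendPerm extendPerm_injective.injOn (fun _ _ => by simp) ?_ ?_
  · intro σ _ hσ
    by_contra hne
    have hord : IsOrderedMatching σ := by
      by_contra h
      exact hne (if_neg h)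
    rw [if_pos hord, pfTerm] at hne
    have hprod := Finset.prod_ne_zero_iff.1 (right_ne_zero_of_mul hne)
    set t : Fin (2 * (n + 1)) := ⟨2 * n + 1, by omega⟩ with ht
    obtain ⟨⟨l, a⟩, hp⟩ := (pairEquiv (n + 1)).surjective (σ.symm t)
    have hpt : σ (pairEquiv (n + 1) (l, a)) = t := by rw [hp, Equiv.apply_symm_apply]
    have hlt := hord.1 l
    have hle : ∀ i : Fin (2 * (n + 1)), (i : ℕ) ≤ 2 * n + 1 := fun i => by omega
    have ha : a = 1 := by
      fin_cases a
      · have := hle (σ (pairEquiv (n + 1) (l, 1)))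
        simp only [Fin.zero_eta] at hpt
        rw [hpt, Fin.lt_def] at hlt
        simp only [ht] at hlt
        omega
      · rfl
    subst ha
    rw [hpt] at hlt
    have hw := hprod l (Finset.mem_univ l)
    rw [hpt] at hw
    have hlt' : (σ (pairEquiv (n + 1) (l, 0)) : ℕ) < 2 * n + 1 := hlt
    have h2n : (σ (pairEquiv (n + 1) (l, 0)) : ℕ) = 2 * n := by
      by_contra hc
      apply hw
      simp only [Matrix.of_apply, border, ht, hlt'.ne, if_false, if_true]
      exact h0 _ (by omega)
    -- The pair `(2n, 2n+1)` must come last: a later pair would start above `2n`, leaving no room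
    -- for its larger element.
    have hl : l = Fin.last n := by
      by_contra hc
      have h3 : σ (pairEquiv (n + 1) (l, 0)) < σ (pairEquiv (n + 1) (Fin.last n, 0)) :=
        hord.2 (lt_of_le_of_ne (Fin.le_last l) hc)
      have h4 := hord.1 (Fin.last n)
      have h5 := hle (σ (pairEquiv (n + 1) (Fin.last n, 1)))
      rw [Fin.lt_def] at h3 h4
      omega
    subst hl
    apply hσ
    obtain ⟨ρ, hρ⟩ := exists_extendPerm σ (fun a => by
      have hpa : ∀ a : Fin 2, (Fin.natAdd (2 * n) a : Fin (2 * (n + 1))) =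
          pairEquiv (n + 1) (Fin.last n, a) := fun a => by
        ext
        simp [pairEquiv]
      fin_cases a
      · simp only [Fin.zero_eta]
        refine (congrArg σ (hpa 0)).trans ?_
        ext
        exact h2n
      · simp only [Fin.mk_one]
        refine (congrArg σ (hpa 1)).trans ?_
        rw [hpt]
        rfl)
    exact ⟨ρ, by simp, hρ⟩
  · intro ρ _
    simp only [isOrderedMatching_extendPerm]
    split_ifs
    · simp only [pfTerm, sign_extendPerm, Fin.prod_univ_castSucc, extendPerm_castSucc,
        extendPerm_last]
      have hlast : (Matrix.of fun i j : Fin (2 * (n + 1)) => border M w (2 * n + 1) i j)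
          (Fin.natAdd (2 * n) 0) (Fin.natAdd (2 * n) 1) = 1 := by
        have e0 : ((Fin.natAdd (2 * n) (0 : Fin 2) : Fin (2 * n + 2)) : ℕ) = 2 * n := by simp
        have e1 : ((Fin.natAdd (2 * n) (1 : Fin 2) : Fin (2 * n + 2)) : ℕ) = 2 * n + 1 := by simp
        have : border M w (2 * n + 1) (2 * n) (2 * n + 1) = 1 := by simp [border, h1]
        exact this
      erw [hlast]
      rw [mul_one]
      congr 1
      refine Finset.prod_congr rfl fun l _ => ?_
      set p := ρ (pairEquiv n (l, 0))
      set q := ρ (pairEquiv n (l, 1))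
      have : border M w (2 * n + 1) p q = M p q := by
        have hp : (p : ℕ) ≠ 2 * n + 1 := by omega
        have hq : (q : ℕ) ≠ 2 * n + 1 := by omega
        simp [border, hp, hq]
      exact this.symm
    · rfl

/-- The map that moves the index `j` to the place `i` and shifts the indices between. -/
def moveIndex (i j k : ℕ) : ℕ :=
  if k < i then k else if k < j then k + 1 else if k = j then i else k

theorem cycleIcc_val {m : ℕ} {i j : Fin m} (hij : i ≤ j) (k : Fin m) :
    (Fin.cycleIcc i j k : ℕ) = moveIndex i j k := by
  have : NeZero m := ⟨by have := k.2; omega⟩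
  unfold moveIndex
  split_ifs with h1 h2 h3
  · rw [Fin.cycleIcc_of_lt (by exact h1)]
  · rw [Fin.cycleIcc_of_ge_of_lt (by rw [Fin.le_def]; omega) (by exact h2)]
    rw [Fin.val_add_one_of_lt' (by omega)]
  · rw [Fin.ext h3, Fin.cycleIcc_of_last hij]
  · rw [Fin.cycleIcc_of_gt (by rw [Fin.lt_def]; omega)]

theorem pfNat_move {n : ℕ} {M M' : ℕ → ℕ → ℝ} (hM : SkewArray M) (i j : ℕ) (hij : i ≤ j)
    (hj : j < 2 * n)
    (h : ∀ a < 2 * n, ∀ b < 2 * n, M' a b = M (moveIndex i j a) (moveIndex i j b)) :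
    pfNat n M' = (-1) ^ (j - i) * pfNat n M := by
  have hle : (⟨i, by omega⟩ : Fin (2 * n)) ≤ ⟨j, hj⟩ := hij
  rw [pfNat_perm hM (Fin.cycleIcc ⟨i, by omega⟩ ⟨j, hj⟩) fun a b => by
    rw [cycleIcc_val hle, cycleIcc_val hle]
    exact h a a.2 b b.2]
  rw [Fin.sign_cycleIcc_of_le hle]
  simp

/-- Expansion along a last column that is a unit vector. -/
theorem pfNat_border_single {n : ℕ} {M : ℕ → ℕ → ℝ} (hM : SkewArray M) (j : ℕ)
    (hj : j ≤ 2 * n) :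
    pfNat (n + 1) (border M (fun i => if i = j then 1 else 0) (2 * n + 1)) =
      (-1) ^ j * pfNat n fun a b => M (if a < j then a else a + 1) (if b < j then b else b + 1) := by
  have h1 := pfNat_move (n := n + 1)
    (M' := border (fun a b => M (moveIndex j (2 * n) a) (moveIndex j (2 * n) b))
      (fun i => if i = 2 * n then 1 else 0) (2 * n + 1))
    (hM.border (fun i => if i = j then 1 else 0) (2 * n + 1)) j (2 * n) hj (by omega)
    (by
      have hmv : ∀ a ≤ 2 * n, moveIndex j (2 * n) a ≠ 2 * n + 1 := by
        intro a ha
        unfold moveIndex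
        split_ifs <;> omega
      have hmv1 : moveIndex j (2 * n) (2 * n + 1) = 2 * n + 1 := by
        unfold moveIndex
        split_ifs <;> omega
      have hmv2 : ∀ a ≤ 2 * n, moveIndex j (2 * n) a = j ↔ a = 2 * n := by
        intro a ha
        unfold moveIndex
        split_ifs <;> omega
      intro a ha b hb
      rcases (show a ≤ 2 * n ∨ a = 2 * n + 1 by omega) with ha' | rfl
      · rcases (show b ≤ 2 * n ∨ b = 2 * n + 1 by omega) with hb' | rfl
        · simp only [border, hmv a ha', hmv b hb', if_false, (show a ≠ 2 * n + 1 by omega),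
            (show b ≠ 2 * n + 1 by omega)]
        · simp only [border, hmv1, if_true, hmv a ha', (show a ≠ 2 * n + 1 by omega), if_false,
            hmv2 a ha']
      · rcases (show b ≤ 2 * n ∨ b = 2 * n + 1 by omega) with hb' | rfl
        · simp only [border, hmv1, if_true, hmv b hb', (show b ≠ 2 * n + 1 by omega), if_false,
            hmv2 b hb']
        · simp [border, hmv1])
  rw [pfNat_border_unit _ _ (by simp) fun i hi => by simp [hi.ne]] at h1
  have h2 : pfNat n (fun a b => M (moveIndex j (2 * n) a) (moveIndex j (2 * n) b)) =
      pfNat n fun a b => M (if a < j then a else a + 1) (if b < j then b else b + 1) :=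
    pfNat_congr fun a ha b hb => by simp [moveIndex, ha, hb]
  have h3 : ((-1 : ℝ)) ^ j * (-1) ^ (2 * n - j) = 1 := by
    rw [← pow_add, Nat.add_sub_cancel' hj, pow_mul]
    simp
  rw [← h2, h1, ← mul_assoc, h3, one_mul]

/-- Moving the border from first to last place is a cycle of odd sign and turns `w` into `-w`.
Undoing that negation costs another sign, and the two cancel. -/
theorem pfNat_borderFirst {n : ℕ} {M : ℕ → ℕ → ℝ} (hM : SkewArray M) (w : ℕ → ℝ) :
    pfNat (n + 1) (borderFirst M w) = pfNat (n + 1) (border M w (2 * n + 1)) := by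
  have h1 : pfNat (n + 1) (border M w (2 * n + 1)) =
      (-1) ^ (2 * n + 1 - 0) * pfNat (n + 1) (borderFirst M fun i => -w i) := by
    refine pfNat_move (hM.borderFirst _) 0 (2 * n + 1) (by omega) (by omega) fun a ha b hb => ?_
    rcases (show a < 2 * n + 1 ∨ a = 2 * n + 1 by omega) with ha' | rfl <;>
    rcases (show b < 2 * n + 1 ∨ b = 2 * n + 1 by omega) with hb' | rfl
    · simp [border, borderFirst, moveIndex, ha', hb', ha'.ne, hb'.ne]
    · simp [border, borderFirst, moveIndex, ha', ha'.ne]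
    · simp [border, borderFirst, moveIndex, hb', hb'.ne]
    · simp [border, borderFirst, moveIndex]
  have h2 : pfNat (n + 1) (borderFirst M fun i => -w i) =
      pfNat (n + 1) fun i j => (fun k => if k = 0 then -1 else 1) i *
        (fun k => if k = 0 then -1 else 1) j * borderFirst M w i j := by
    refine pfNat_congr fun a _ b _ => ?_
    simp only [borderFirst]
    split_ifs <;> simp
  have h3 : ∏ i : Fin (2 * (n + 1)), (fun k : ℕ => if k = 0 then (-1 : ℝ) else 1) i = -1 := by
    rw [Fin.prod_univ_eq_prod_range (fun k : ℕ => if k = 0 then (-1 : ℝ) else 1)]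
    rw [Finset.prod_ite_eq' (Finset.range (2 * (n + 1))) 0 fun _ => (-1 : ℝ)]
    simp
  rw [h1, h2, pfNat_scale, h3, Nat.sub_zero, pow_succ, pow_mul]
  simp

end PfaffianBorder

/-! ### The `τ` and `Q_k` as bordered Pfaffians, evaluated through solutions of the moment system.
-/

section Moments

/-- The array `J_{l+i,l+j}`. -/
def bimomentArray (μ : Measure ℝ) (l : ℤ) (i j : ℕ) : ℝ :=
  skewBimoment μ (l + (i : ℕ)) (l + (j : ℕ))

/-- The sequence `β_{l+j}`. -/
def momentSeq (μ : Measure ℝ) (l : ℤ) (j : ℕ) : ℝ := moment μ (l + (j : ℕ))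

theorem tau_even (μ : Measure ℝ) (l : ℤ) (n : ℕ) :
    tau μ l ((2 * n : ℕ) : ℤ) = pfNat n (bimomentArray μ l) := by
  rw [tau, if_neg (by omega), if_pos (by exact_mod_cast even_two_mul n)]
  change pfNat _ (fun i j => skewBimoment μ (l + (i : ℕ)) (l + (j : ℕ))) = _
  rw [Int.toNat_natCast, Nat.mul_div_cancel_left _ two_pos]
  rfl

theorem tau_odd (μ : Measure ℝ) (l : ℤ) (n : ℕ) :
    tau μ l ((2 * n + 1 : ℕ) : ℤ) =
      pfNat (n + 1) (borderFirst (bimomentArray μ l) (momentSeq μ l)) := by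
  have hodd : ¬Even ((2 * n + 1 : ℕ) : ℤ) := by
    rw [Int.even_coe_nat, Nat.not_even_iff_odd]
    exact odd_two_mul_add_one n
  rw [tau, if_neg (by omega), if_neg hodd]
  change pfNat _ (fun i j => if i = 0 then (if j = 0 then 0 else moment μ (l + (j : ℕ) - 1))
      else if j = 0 then -moment μ (l + (i : ℕ) - 1)
      else skewBimoment μ (l + (i : ℕ) - 1) (l + (j : ℕ) - 1)) = _
  rw [Int.toNat_natCast, show (2 * n + 1 + 1) / 2 = n + 1 by omega]
  refine pfNat_congr fun i _ j _ => ?_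
  rcases i with _ | i <;> rcases j with _ | j <;>
    simp [borderFirst, bimomentArray, momentSeq, add_sub_assoc]

theorem polyQ_odd (μ : Measure ℝ) (n : ℕ) (z : ℝ) :
    polyQ μ (2 * n + 1) z = 2 * z / tau μ 0 ((2 * n + 1 : ℕ) : ℤ) *
      pfNat (n + 1) (border (bimomentArray μ 0) (fun i => z ^ i) (2 * n + 1)) := by
  rw [polyQ, if_neg (by rw [Nat.not_even_iff_odd]; exact odd_two_mul_add_one n)]
  congr 1
  change pfNat _ (fun i j => if i = 2 * n + 1 then (if j = 2 * n + 1 then 0 else -z ^ j)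
    else if j = 2 * n + 1 then z ^ i else skewBimoment μ (i : ℕ) (j : ℕ)) = _
  rw [show (2 * n + 1 + 1) / 2 = n + 1 by omega]
  refine pfNat_congr fun i _ j _ => ?_
  simp [border, bimomentArray]

theorem polyQ_even (μ : Measure ℝ) (n : ℕ) (z : ℝ) :
    polyQ μ (2 * n) z = -2 * z / tau μ 0 ((2 * n : ℕ) : ℤ) *
      pfNat (n + 1) (border (borderFirst (bimomentArray μ 0) (momentSeq μ 0))
        (fun i => if i = 0 then 0 else z ^ (i - 1)) (2 * n + 1)) := by
  rw [polyQ, if_pos (even_two_mul n)]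
  congr 1
  change pfNat _ (fun i j => if i = 0 then
          (if j = 0 ∨ j = 2 * n + 1 then 0 else moment μ ((j : ℕ) - 1))
        else if i = 2 * n + 1 then
          (if j = 0 ∨ j = 2 * n + 1 then 0 else -z ^ (j - 1))
        else if j = 0 then -moment μ ((i : ℕ) - 1)
        else if j = 2 * n + 1 then z ^ (i - 1)
        else skewBimoment μ ((i : ℕ) - 1) ((j : ℕ) - 1)) = _
  rw [Nat.mul_div_cancel_left _ two_pos]
  refine pfNat_congr fun i _ j _ => ?_
  rcases i with _ | i <;> rcases j with _ | j
  · simp [border, borderFirst]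
  · by_cases hj : j = 2 * n <;> simp [border, borderFirst, momentSeq, hj]
  · by_cases hi : i = 2 * n <;> simp [border, borderFirst, momentSeq, hi]
  · by_cases hi : i = 2 * n <;> by_cases hj : j = 2 * n <;>
      simp [border, borderFirst, bimomentArray, hi, hj]

section Odd

variable {μ : Measure ℝ} {n : ℕ} {r : ℕ → ℝ}

/-- Cramer's rule for odd `k`: `r` spans a kernel direction of the odd skew matrix `J`, and
bordering by `β` itself fixes the constant. Different `w` extract different data: unit vectors the
coefficients of `r`, powers of `z` the polynomial `Q_k`, and the row of index `-1` the shifted `τ`.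
-/
theorem odd_pfaffian_solution (hJ : SkewArray (bimomentArray μ 0))
    (hr : ∀ i < 2 * n + 1, ∑ j ∈ Finset.range (2 * n + 1), bimomentArray μ 0 i j * r j = 0)
    (hβ : ∑ j ∈ Finset.range (2 * n + 1), r j * momentSeq μ 0 j = 2) (w : ℕ → ℝ) :
    2 * pfNat (n + 1) (border (bimomentArray μ 0) w (2 * n + 1)) =
      tau μ 0 ((2 * n + 1 : ℕ) : ℤ) * ∑ j ∈ Finset.range (2 * n + 1), r j * w j := by
  have := pfNat_border_mul hJ r w (momentSeq μ 0) hr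
  rw [hβ, ← pfNat_borderFirst hJ (momentSeq μ 0), ← tau_odd] at this
  rw [← this]
  ring

theorem odd_last_coeff (hJ : SkewArray (bimomentArray μ 0))
    (hr : ∀ i < 2 * n + 1, ∑ j ∈ Finset.range (2 * n + 1), bimomentArray μ 0 i j * r j = 0)
    (hβ : ∑ j ∈ Finset.range (2 * n + 1), r j * momentSeq μ 0 j = 2) :
    tau μ 0 ((2 * n + 1 : ℕ) : ℤ) * r (2 * n) = 2 * tau μ 0 ((2 * n : ℕ) : ℤ) := by
  have := odd_pfaffian_solution hJ hr hβ fun i => if i = 2 * n then 1 else 0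
  rw [pfNat_border_single hJ _ le_rfl] at this
  simp only [mul_ite, mul_one, mul_zero, Finset.sum_ite_eq', Finset.mem_range] at this
  rw [if_pos (by omega), (even_two_mul n).neg_one_pow, one_mul] at this
  rw [← this, tau_even]
  congr 1
  exact pfNat_congr fun i hi j hj => by simp [hi, hj]

theorem odd_first_coeff (hJ : SkewArray (bimomentArray μ 0))
    (hr : ∀ i < 2 * n + 1, ∑ j ∈ Finset.range (2 * n + 1), bimomentArray μ 0 i j * r j = 0)
    (hβ : ∑ j ∈ Finset.range (2 * n + 1), r j * momentSeq μ 0 j = 2) :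
    tau μ 0 ((2 * n + 1 : ℕ) : ℤ) * r 0 = 2 * tau μ 1 ((2 * n : ℕ) : ℤ) := by
  have := odd_pfaffian_solution hJ hr hβ fun i => if i = 0 then 1 else 0
  rw [pfNat_border_single hJ _ (Nat.zero_le _)] at this
  simp only [mul_ite, mul_one, mul_zero, Finset.sum_ite_eq', Finset.mem_range] at this
  rw [if_pos (by omega), pow_zero, one_mul] at this
  rw [← this, tau_even]
  congr 1
  exact pfNat_congr fun i hi j hj => by simp [bimomentArray, add_comm]

theorem odd_polyQ (hJ : SkewArray (bimomentArray μ 0))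
    (hr : ∀ i < 2 * n + 1, ∑ j ∈ Finset.range (2 * n + 1), bimomentArray μ 0 i j * r j = 0)
    (hβ : ∑ j ∈ Finset.range (2 * n + 1), r j * momentSeq μ 0 j = 2)
    (hτ : tau μ 0 ((2 * n + 1 : ℕ) : ℤ) ≠ 0) (z : ℝ) :
    polyQ μ (2 * n + 1) z = z * ∑ j ∈ Finset.range (2 * n + 1), r j * z ^ j := by
  have := odd_pfaffian_solution hJ hr hβ fun i => z ^ i
  rw [polyQ_odd]
  field_simp
  linear_combination z * this

/-- Bordering the array `J_{i,j}` by the row `J_{-1,j}` in first place produces the array with all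
indices lowered by one, of size larger by one. -/
theorem odd_shifted (hJ : SkewArray (bimomentArray μ 0)) (hJ' : SkewArray (bimomentArray μ (-1)))
    (hr : ∀ i < 2 * n + 1, ∑ j ∈ Finset.range (2 * n + 1), bimomentArray μ 0 i j * r j = 0)
    (hβ : ∑ j ∈ Finset.range (2 * n + 1), r j * momentSeq μ 0 j = 2) :
    tau μ 0 ((2 * n + 1 : ℕ) : ℤ) *
      ∑ j ∈ Finset.range (2 * n + 1), r j * bimomentArray μ (-1) 0 (j + 1) =
        2 * tau μ (-1) ((2 * n + 2 : ℕ) : ℤ) := by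
  rw [← odd_pfaffian_solution hJ hr hβ, ← pfNat_borderFirst hJ,
    show 2 * n + 2 = 2 * (n + 1) by ring, tau_even]
  congr 1
  refine pfNat_congr fun i _ j _ => ?_
  rcases i with _ | i <;> rcases j with _ | j
  · have := hJ' 0 0
    have h0 : bimomentArray μ (-1) 0 0 = 0 := by linarith
    simp [borderFirst, h0]
  · simp [borderFirst]
  · simp [borderFirst, hJ' (i + 1) 0]
  · simp [borderFirst, bimomentArray]

end Odd

section Even

variable {μ : Measure ℝ} {n : ℕ} {r : ℕ → ℝ}

/-- For even `k` the matrix `J` bordered by `β` has odd size, and the system for `r` says that `(-2,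
r)` is in its kernel. The constant is fixed by the border vector `(1, 0, …, 0)`, whose Pfaffian is
`τ_k`. -/
theorem even_pfaffian_solution (hJ : SkewArray (bimomentArray μ 0))
    (hr : ∀ i < 2 * n, ∑ j ∈ Finset.range (2 * n), bimomentArray μ 0 i j * r j =
      -2 * momentSeq μ 0 i)
    (hβ : ∑ j ∈ Finset.range (2 * n), r j * momentSeq μ 0 j = 0) (w : ℕ → ℝ) :
    -2 * pfNat (n + 1) (border (borderFirst (bimomentArray μ 0) (momentSeq μ 0)) w (2 * n + 1)) =
      tau μ 0 ((2 * n : ℕ) : ℤ) *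
        (-2 * w 0 + ∑ j ∈ Finset.range (2 * n), r j * w (j + 1)) := by
  set v : ℕ → ℝ := fun i => if i = 0 then -2 else r (i - 1) with hv
  have h1 := pfNat_border_mul (n := n) (hJ.borderFirst (momentSeq μ 0)) v w
    (fun i => if i = 0 then 1 else 0) (by
      intro i hi
      rw [Finset.sum_range_succ']
      rcases i with _ | i
      · simpa [borderFirst, hv, mul_comm] using hβ
      · have := hr i (by omega)
        simp only [borderFirst, hv, Nat.add_eq_zero_iff, one_ne_zero, and_false, if_false,
          Nat.add_sub_cancel, if_true, this]
        ring)
  rw [pfNat_border_single (hJ.borderFirst _) _ (Nat.zero_le _)] at h1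
  have h2 : pfNat n (fun a b => borderFirst (bimomentArray μ 0) (momentSeq μ 0)
      (if a < 0 then a else a + 1) (if b < 0 then b else b + 1)) =
      tau μ 0 ((2 * n : ℕ) : ℤ) := by
    rw [tau_even]
    exact pfNat_congr fun i _ j _ => by simp [borderFirst]
  rw [h2, Finset.sum_range_succ', Finset.sum_range_succ' (fun j => v j * w j)] at h1
  have hv0 : v 0 = -2 := rfl
  have hvs : ∀ j, v (j + 1) = r j := fun j => rfl
  simp only [hv0, hvs, pow_zero, Nat.add_eq_zero_iff, one_ne_zero, and_false, if_false, if_true,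
    mul_zero, Finset.sum_const_zero] at h1
  linear_combination h1

theorem even_last_coeff (hn : 0 < n) (hJ : SkewArray (bimomentArray μ 0))
    (hr : ∀ i < 2 * n, ∑ j ∈ Finset.range (2 * n), bimomentArray μ 0 i j * r j =
      -2 * momentSeq μ 0 i)
    (hβ : ∑ j ∈ Finset.range (2 * n), r j * momentSeq μ 0 j = 0) :
    tau μ 0 ((2 * n : ℕ) : ℤ) * r (2 * n - 1) = -2 * tau μ 0 ((2 * n - 1 : ℕ) : ℤ) := by
  obtain ⟨m, rfl⟩ : ∃ m, n = m + 1 := ⟨n - 1, by omega⟩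
  have := even_pfaffian_solution hJ hr hβ fun i => if i = 2 * (m + 1) then 1 else 0
  rw [pfNat_border_single (hJ.borderFirst _) _ le_rfl] at this
  simp only [mul_ite, mul_one, mul_zero, (show ∀ j, j + 1 = 2 * (m + 1) ↔ j = 2 * m + 1 by omega),
    Finset.sum_ite_eq', Finset.mem_range] at this
  rw [if_neg (by omega), if_pos (by omega), (even_two_mul (m + 1)).neg_one_pow, one_mul,
    zero_add] at this
  rw [show 2 * (m + 1) - 1 = 2 * m + 1 by omega, ← this, tau_odd]
  congr 1
  exact pfNat_congr fun i hi j hj => by simp only [hi, hj, if_true]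

theorem even_first_coeff (hn : 0 < n) (hJ : SkewArray (bimomentArray μ 0))
    (hr : ∀ i < 2 * n, ∑ j ∈ Finset.range (2 * n), bimomentArray μ 0 i j * r j =
      -2 * momentSeq μ 0 i)
    (hβ : ∑ j ∈ Finset.range (2 * n), r j * momentSeq μ 0 j = 0) :
    tau μ 0 ((2 * n : ℕ) : ℤ) * r 0 = 2 * tau μ 1 ((2 * n - 1 : ℕ) : ℤ) := by
  obtain ⟨m, rfl⟩ : ∃ m, n = m + 1 := ⟨n - 1, by omega⟩
  have := even_pfaffian_solution hJ hr hβ fun i => if i = 1 then 1 else 0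
  rw [pfNat_border_single (hJ.borderFirst _) _ (by omega)] at this
  simp only [mul_ite, mul_one, mul_zero, Nat.add_eq_right,
    Finset.sum_ite_eq', Finset.mem_range] at this
  rw [if_neg (by omega), if_pos (by omega), zero_add] at this
  rw [show 2 * (m + 1) - 1 = 2 * m + 1 by omega, ← this, tau_odd, pow_one]
  -- Deleting the row and column of moment index `0`, while keeping the `β` border, raises all
  -- moment indices by one.
  have h2 : pfNat (m + 1) (fun a b => borderFirst (bimomentArray μ 0) (momentSeq μ 0)
      (if a < 1 then a else a + 1) (if b < 1 then b else b + 1)) =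
      pfNat (m + 1) (borderFirst (bimomentArray μ 1) (momentSeq μ 1)) := by
    refine pfNat_congr fun i _ j _ => ?_
    rcases i with _ | i <;> rcases j with _ | j <;>
      simp [borderFirst, bimomentArray, momentSeq, add_comm]
  rw [h2]
  ring

theorem even_polyQ (hJ : SkewArray (bimomentArray μ 0))
    (hr : ∀ i < 2 * n, ∑ j ∈ Finset.range (2 * n), bimomentArray μ 0 i j * r j =
      -2 * momentSeq μ 0 i)
    (hβ : ∑ j ∈ Finset.range (2 * n), r j * momentSeq μ 0 j = 0)
    (hτ : tau μ 0 ((2 * n : ℕ) : ℤ) ≠ 0) (z : ℝ) :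
    polyQ μ (2 * n) z = z * ∑ j ∈ Finset.range (2 * n), r j * z ^ j := by
  have := even_pfaffian_solution hJ hr hβ fun i => if i = 0 then 0 else z ^ (i - 1)
  rw [if_pos rfl, mul_zero, zero_add] at this
  simp only [Nat.add_eq_zero_iff, one_ne_zero, and_false, if_false, Nat.add_sub_cancel] at this
  rw [polyQ_even]
  field_simp
  linear_combination z * this

theorem even_shifted (hJ : SkewArray (bimomentArray μ 0)) (hJ' : SkewArray (bimomentArray μ (-1)))
    (hr : ∀ i < 2 * n, ∑ j ∈ Finset.range (2 * n), bimomentArray μ 0 i j * r j =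
      -2 * momentSeq μ 0 i)
    (hβ : ∑ j ∈ Finset.range (2 * n), r j * momentSeq μ 0 j = 0) :
    tau μ 0 ((2 * n : ℕ) : ℤ) *
      (2 * momentSeq μ (-1) 0 +
        ∑ j ∈ Finset.range (2 * n), r j * bimomentArray μ (-1) 0 (j + 1)) =
        2 * tau μ (-1) ((2 * n + 1 : ℕ) : ℤ) := by
  have h1 := even_pfaffian_solution hJ hr hβ fun i =>
    if i = 0 then momentSeq μ (-1) 0 else -bimomentArray μ (-1) 0 i
  -- The last row and column of this array carry moment index `-1`. Moving them to place `1`, just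
  -- behind the `β` border, is an even cycle of length `2n + 1` and gives the array of `τ^{(-1)}`.
  have h2 : pfNat (n + 1) (border (borderFirst (bimomentArray μ 0) (momentSeq μ 0))
      (fun i => if i = 0 then momentSeq μ (-1) 0 else -bimomentArray μ (-1) 0 i) (2 * n + 1)) =
      (-1) ^ (2 * n + 1 - 1) *
        pfNat (n + 1) (borderFirst (bimomentArray μ (-1)) (momentSeq μ (-1))) := by
    refine pfNat_move (hJ'.borderFirst _) 1 (2 * n + 1) (by omega) (by omega) fun a ha b hb => ?_
    have h00 : bimomentArray μ (-1) 0 0 = 0 := by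
      have := hJ' 0 0
      linarith
    have hm : ∀ a, a + 1 < 2 * n + 1 → moveIndex 1 (2 * n + 1) (a + 1) = a + 2 := fun a h => by
      simp [moveIndex, h]
    have hm0 : moveIndex 1 (2 * n + 1) 0 = 0 := by simp [moveIndex]
    have hm1 : moveIndex 1 (2 * n + 1) (2 * n + 1) = 1 := by simp [moveIndex]
    have hcases : ∀ a < 2 * (n + 1), a = 0 ∨ a = 2 * n + 1 ∨ ∃ c, a = c + 1 ∧ c + 1 < 2 * n + 1 :=
      fun a h => by
        rcases a with _ | c
        · simp
        · rcases (show c + 1 < 2 * n + 1 ∨ c + 1 = 2 * n + 1 by omega) with h | h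
          · exact Or.inr (Or.inr ⟨c, rfl, h⟩)
          · exact Or.inr (Or.inl h)
    rcases hcases a ha with rfl | rfl | ⟨c, rfl, hc⟩ <;>
    rcases hcases b hb with rfl | rfl | ⟨d, rfl, hd⟩
    · simp [border, borderFirst, hm0]
    · simp [border, borderFirst, hm0, hm1]
    · rw [hm d hd, hm0]
      have : d ≠ 2 * n := by omega
      simp [border, borderFirst, momentSeq, this]
    · simp [border, borderFirst, hm0, hm1]
    · simp [border, borderFirst, hm1, h00]
    · rw [hm d hd, hm1]
      have : d ≠ 2 * n := by omega
      simp [border, borderFirst, this]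
    · rw [hm c hc, hm0]
      have : c ≠ 2 * n := by omega
      simp [border, borderFirst, momentSeq, this]
    · rw [hm c hc, hm1]
      have : c ≠ 2 * n := by omega
      simp [border, borderFirst, hJ' 0 (c + 1), this]
    · rw [hm c hc, hm d hd]
      have h3 : c ≠ 2 * n := by omega
      have h4 : d ≠ 2 * n := by omega
      simp [border, borderFirst, bimomentArray, h3, h4]
  rw [h2, Nat.add_sub_cancel, (even_two_mul n).neg_one_pow, one_mul, ← tau_odd] at h1
  simp only [if_true, Nat.add_eq_zero_iff, one_ne_zero, and_false, if_false, mul_neg,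
    Finset.sum_neg_distrib] at h1
  linear_combination h1

end Even

end Moments

/-! ### Products of transition matrices acting on polynomial vectors: invariants, degrees, leading
signs. -/

section Chains

open Polynomial

/-- The transition matrix at `ε z`, with `ε = ±1`, `e = (m e^x, m e^{-x})`, applied to a vector of
polynomials. -/
def polyStep (ε : ℝ) (e : ℝ × ℝ) (v : Fin 3 → ℝ[X]) : Fin 3 → ℝ[X] :=
  ![v 0 - C (ε * e.1 * e.2) * (X * v 0) - C (2 * ε * e.2) * (X * v 1) -
      C (e.2 ^ 2) * (X * (X * v 2)),
    C e.1 * v 0 + v 1 + C (ε * e.2) * (X * v 2),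
    C (e.1 ^ 2) * v 0 + C (2 * e.1) * v 1 + v 2 + C (ε * e.1 * e.2) * (X * v 2)]

/-- Successive application of the transition matrices, the last one in the list first. -/
def polyChain (ε : ℝ) (L : List (ℝ × ℝ)) (v : Fin 3 → ℝ[X]) : Fin 3 → ℝ[X] :=
  L.foldr (polyStep ε) v

@[simp] theorem polyChain_nil (ε : ℝ) (v : Fin 3 → ℝ[X]) : polyChain ε [] v = v := rfl

@[simp] theorem polyChain_cons (ε : ℝ) (e : ℝ × ℝ) (L : List (ℝ × ℝ)) (v : Fin 3 → ℝ[X]) :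
    polyChain ε (e :: L) v = polyStep ε e (polyChain ε L v) := rfl

theorem polyChain_append (ε : ℝ) (L L' : List (ℝ × ℝ)) (v : Fin 3 → ℝ[X]) :
    polyChain ε (L ++ L') v = polyChain ε L (polyChain ε L' v) := by
  simp [polyChain]

/-- The transition matrix in terms of `e = (m e^x, m e^{-x})`. -/
def transitionPair (z : ℝ) (e : ℝ × ℝ) : Matrix (Fin 3) (Fin 3) ℝ :=
  !![1 - z * (e.1 * e.2), -2 * z * e.2, -z ^ 2 * e.2 ^ 2;
     e.1, 1, z * e.2;
     e.1 ^ 2, 2 * e.1, 1 + z * (e.1 * e.2)]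

theorem transition_eq (x m z : ℝ) :
    transition x m z = transitionPair z (m * Real.exp x, m * Real.exp (-x)) := by
  have h1 : Real.exp x * Real.exp (-x) = 1 := by rw [← Real.exp_add]; simp
  have h2 : Real.exp (2 * x) = Real.exp x ^ 2 := by rw [← Real.exp_nat_mul]; simp
  have h3 : Real.exp (-2 * x) = Real.exp (-x) ^ 2 := by
    rw [← Real.exp_nat_mul]
    congr 1
    push_cast
    ring
  have h4 : m * Real.exp x * (m * Real.exp (-x)) = m ^ 2 := by
    linear_combination m ^ 2 * h1
  simp only [transition, transitionPair, h2, h3, h4]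
  ext i j
  fin_cases i <;> fin_cases j <;> simp <;> ring

theorem eval_polyStep (e : ℝ × ℝ) (v : Fin 3 → ℝ[X]) (z : ℝ) :
    (fun i => (polyStep 1 e v i).eval z) = (transitionPair z e).mulVec fun i => (v i).eval z := by
  funext i
  fin_cases i <;>
    simp [polyStep, transitionPair, Matrix.mulVec, dotProduct, Fin.sum_univ_three] <;> ring

theorem eval_polyChain (L : List (ℝ × ℝ)) (v : Fin 3 → ℝ[X]) (z : ℝ) :
    (fun i => (polyChain 1 L v i).eval z) =
      ((L.map (transitionPair z)).prod).mulVec fun i => (v i).eval z := by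
  induction L with
  | nil => simp
  | cons e L ih =>
    rw [polyChain_cons, eval_polyStep, ih, List.map_cons, List.prod_cons, Matrix.mulVec_mulVec]

/-- The bilinear form preserved by `(S(-z), S(z))`. -/
def pairing (p q : Fin 3 → ℝ) : ℝ := p 0 * q 2 - 2 * (p 1 * q 1) + p 2 * q 0

/-- Evaluated at an eigenvalue, where `A_N` vanishes, this invariance yields `C_N` from `B_N`, and
the inner vector from the second column. -/
theorem pairing_polyChain (L : List (ℝ × ℝ)) (u v : Fin 3 → ℝ[X]) (z : ℝ) :
    pairing (fun i => (polyChain 1 L u i).eval (-z)) (fun i => (polyChain 1 L v i).eval z) =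
      pairing (fun i => (u i).eval (-z)) (fun i => (v i).eval z) := by
  induction L with
  | nil => rfl
  | cons e L ih =>
    rw [← ih, polyChain_cons, polyChain_cons]
    simp [pairing, polyStep]
    ring

/-- The `2 × 2` minors of a pair of vectors, ordered so that they transform like a vector. -/
def minors (v u : Fin 3 → ℝ[X]) : Fin 3 → ℝ[X] :=
  ![v 0 * u 1 - v 1 * u 0, C (1 / 2) * (v 0 * u 2 - v 2 * u 0), v 1 * u 2 - v 2 * u 1]

/-- The compound of the transition matrix at `z`, in this ordering and scaling of minors, is the
transition matrix at `-z`. Hence minors obey the same degree and sign estimates as vectors, with `ε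
= -1`. -/
theorem minors_polyStep (e : ℝ × ℝ) (v u : Fin 3 → ℝ[X]) :
    minors (polyStep 1 e v) (polyStep 1 e u) = polyStep (-1) e (minors v u) := by
  funext i
  refine Polynomial.funext fun z => ?_
  fin_cases i <;> simp [minors, polyStep] <;> ring

theorem minors_polyChain (L : List (ℝ × ℝ)) (v u : Fin 3 → ℝ[X]) :
    minors (polyChain 1 L v) (polyChain 1 L u) = polyChain (-1) L (minors v u) := by
  induction L with
  | nil => rfl
  | cons e L ih => rw [polyChain_cons, polyChain_cons, polyChain_cons, minors_polyStep, ih]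

theorem coeff_polyStep_zero_succ (ε : ℝ) (e : ℝ × ℝ) (v : Fin 3 → ℝ[X]) (i : ℕ) :
    (polyStep ε e v 0).coeff (i + 1) = (v 0).coeff (i + 1) - ε * e.1 * e.2 * (v 0).coeff i -
      2 * ε * e.2 * (v 1).coeff i - e.2 ^ 2 * (X * v 2).coeff i := by
  simp only [polyStep, Matrix.cons_val_zero, coeff_sub, coeff_C_mul, coeff_X_mul]

theorem coeff_polyStep_one (ε : ℝ) (e : ℝ × ℝ) (v : Fin 3 → ℝ[X]) (i : ℕ) :
    (polyStep ε e v 1).coeff i =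
      e.1 * (v 0).coeff i + (v 1).coeff i + ε * e.2 * (X * v 2).coeff i := by
  simp only [polyStep, Matrix.cons_val_one, Matrix.cons_val_zero, coeff_add, coeff_C_mul]

theorem coeff_polyStep_two (ε : ℝ) (e : ℝ × ℝ) (v : Fin 3 → ℝ[X]) (i : ℕ) :
    (polyStep ε e v 2).coeff i = e.1 ^ 2 * (v 0).coeff i + 2 * e.1 * (v 1).coeff i +
      (v 2).coeff i + ε * e.1 * e.2 * (X * v 2).coeff i := by
  simp only [polyStep, Matrix.cons_val, coeff_add, coeff_C_mul]

/-- Degrees at most `n`, `n - 1`, `n - 1` for the three entries. -/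
structure HasDegree (n : ℕ) (v : Fin 3 → ℝ[X]) : Prop where
  fst : ∀ i, n < i → (v 0).coeff i = 0
  snd : ∀ i, n ≤ i → (v 1).coeff i = 0
  trd : ∀ i, n ≤ i → (v 2).coeff i = 0

/-- The factor `X ^ 2` in the first row multiplies only the third entry, whose degree bound is lower
by one; so the degree grows by one, not by two. -/
theorem HasDegree.polyStep {n : ℕ} {v : Fin 3 → ℝ[X]} (h : HasDegree n v) (ε : ℝ) (e : ℝ × ℝ) :
    HasDegree (n + 1) (polyStep ε e v) := by
  obtain ⟨h0, h1, h2⟩ := h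
  refine ⟨fun i hi => ?_, fun i hi => ?_, fun i hi => ?_⟩
  · obtain ⟨j, rfl⟩ : ∃ j, i = j + 2 := ⟨i - 2, by omega⟩
    rw [coeff_polyStep_zero_succ, h0 _ (by omega), h0 _ (by omega), h1 _ (by omega), coeff_X_mul,
      h2 _ (by omega)]
    ring
  · obtain ⟨j, rfl⟩ : ∃ j, i = j + 1 := ⟨i - 1, by omega⟩
    rw [coeff_polyStep_one, h0 _ (by omega), h1 _ (by omega), coeff_X_mul, h2 _ (by omega)]
    ring
  · obtain ⟨j, rfl⟩ : ∃ j, i = j + 1 := ⟨i - 1, by omega⟩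
    rw [coeff_polyStep_two, h0 _ (by omega), h1 _ (by omega), coeff_X_mul, h2 _ (by omega),
      h2 _ (by omega)]
    ring

theorem HasDegree.polyChain {n : ℕ} {v : Fin 3 → ℝ[X]} (h : HasDegree n v) (ε : ℝ)
    (L : List (ℝ × ℝ)) : HasDegree (n + L.length) (polyChain ε L v) := by
  induction L with
  | nil => exact h
  | cons e L ih => exact ih.polyStep ε e

/-- Sign of the leading coefficient of the first entry along a chain with decreasing ratios. -/
theorem leading_polyChain {ε : ℝ} (hε : ε ^ 2 = 1) {n : ℕ} {t₀ : ℝ} {v : Fin 3 → ℝ[X]}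
    (h : HasDegree n v) (ht : (X * v 2).coeff n = -ε * t₀ * (v 0).coeff n)
    (L : List (ℝ × ℝ)) (hL : L.Pairwise fun a b => b.1 * a.2 < a.1 * b.2)
    (hpos : ∀ e ∈ L, 0 < e.2 ∧ t₀ * e.2 < e.1) :
    ∃ κ > 0, ∃ t, (polyChain ε L v 0).coeff (n + L.length) =
        (-ε) ^ L.length * κ * (v 0).coeff n ∧
      (X * polyChain ε L v 2).coeff (n + L.length) =
        -ε * t * (polyChain ε L v 0).coeff (n + L.length) ∧
      ∀ e : ℝ × ℝ, 0 < e.2 → t₀ * e.2 < e.1 → (∀ b ∈ L, b.1 * e.2 < e.1 * b.2) →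
        t * e.2 < e.1 := by
  induction L with
  | nil => exact ⟨1, one_pos, t₀, by simp, by simpa using ht, fun e _ h _ => h⟩
  | cons e L ih =>
    rw [List.pairwise_cons] at hL
    obtain ⟨κ, hκ, t, h1, h2, h3⟩ := ih hL.2 fun b hb => hpos b (by simp [hb])
    obtain ⟨he2, het⟩ := hpos e (by simp)
    have hlt := h3 e he2 het fun b hb => hL.1 b hb
    have hd := h.polyChain ε L
    set a := (polyChain ε L v 0).coeff (n + L.length) with ha
    have hlen : n + (e :: L).length = n + L.length + 1 := by simp; ring
    have k0 : (polyChain ε (e :: L) v 0).coeff (n + (e :: L).length) =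
        -ε * e.2 * (e.1 - t * e.2) * a := by
      rw [hlen, polyChain_cons]
      rw [coeff_polyStep_zero_succ, hd.fst _ (by omega), hd.snd _ le_rfl, h2, ← ha]
      ring
    have k2 : (X * polyChain ε (e :: L) v 2).coeff (n + (e :: L).length) =
        e.1 * (e.1 - t * e.2) * a := by
      rw [hlen, polyChain_cons]
      rw [coeff_X_mul, coeff_polyStep_two, hd.snd _ le_rfl, hd.trd _ le_rfl, h2, ← ha]
      linear_combination (-e.1 * e.2 * t * a) * hε
    -- After a step the ratio of top coefficients depends only on the pair just applied: `t` becomes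
    -- `e.1 / e.2`, which is `e^{2x}` for a peakon. Moving right raises this quotient, so each new
    -- factor `e.1 - t * e.2` is positive.
    refine ⟨κ * (e.2 * (e.1 - t * e.2)), ?_, e.1 / e.2, ?_, ?_, ?_⟩
    · exact mul_pos hκ (mul_pos he2 (by linarith))
    · rw [k0, h1, List.length_cons]
      ring
    · rw [k0, k2]
      field_simp
      linear_combination (-(e.1 * (e.1 - t * e.2) * a)) * hε
    · intro b hb2 _ hb
      have := hb e (by simp)
      rw [div_mul_eq_mul_div, div_lt_iff₀ he2]
      linarith

/-- The second unit vector. -/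
def unitTwo : Fin 3 → ℝ[X] := ![0, 1, 0]

/-- The first unit vector. -/
def unitOne : Fin 3 → ℝ[X] := ![1, 0, 0]

theorem hasDegree_unitOne : HasDegree 0 unitOne := by
  refine ⟨fun i hi => ?_, fun i _ => ?_, fun i _ => ?_⟩ <;> simp [unitOne]
  rw [coeff_one, if_neg (by omega)]

theorem hasDegree_polyStep_unitTwo (ε : ℝ) (e : ℝ × ℝ) : HasDegree 1 (polyStep ε e unitTwo) := by
  refine ⟨fun i hi => ?_, fun i hi => ?_, fun i hi => ?_⟩
  · obtain ⟨j, rfl⟩ : ∃ j, i = j + 2 := ⟨i - 2, by omega⟩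
    rw [coeff_polyStep_zero_succ]
    simp [unitTwo, coeff_one]
  · simp [polyStep, unitTwo, coeff_one, (show i ≠ 0 by omega)]
  · simp [polyStep, unitTwo, coeff_C, (show i ≠ 0 by omega)]

/-- The constant second entry of `unitTwo` violates the degree pattern, so the first step is made by
hand: it gives `(-2 e.2 X, 1, 2 e.1)`, with starting ratio `e.1 / e.2`. -/
theorem leading_polyChain_unitTwo (L : List (ℝ × ℝ)) (e : ℝ × ℝ)
    (hL : (L ++ [e]).Pairwise fun a b => b.1 * a.2 < a.1 * b.2)
    (hpos : ∀ b ∈ L ++ [e], 0 < b.2) :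
    0 < (-1) ^ (L.length + 1) * (polyChain 1 (L ++ [e]) unitTwo 0).coeff (L.length + 1) := by
  rw [polyChain_append, polyChain_cons, polyChain_nil]
  rw [List.pairwise_append] at hL
  have he : 0 < e.2 := hpos e (by simp)
  have h0 : (polyStep 1 e unitTwo 0).coeff 1 = -2 * e.2 := by
    simp [polyStep, unitTwo]
  obtain ⟨κ, hκ, t, h1, -, -⟩ := leading_polyChain (ε := 1) (by norm_num)
    (hasDegree_polyStep_unitTwo 1 e) (t₀ := e.1 / e.2) (by
      rw [h0]
      field_simp
      simp [polyStep, unitTwo]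
      ring) L hL.1 fun b hb => ⟨hpos b (by simp [hb]), by
        have := hL.2.2 b hb e (by simp)
        rw [div_mul_eq_mul_div, div_lt_iff₀ he]
        exact this⟩
  rw [add_comm] at h1
  rw [h1, h0]
  have : (-1 : ℝ) ^ (L.length + 1) * ((-1) ^ L.length * κ * (-2 * e.2)) =
      ((-1) ^ L.length * (-1) ^ L.length) * (2 * κ * e.2) := by ring
  rw [this, ← mul_pow]
  simp only [neg_mul_neg, one_mul, one_pow]
  positivity

theorem hasDegree_unitTwo (L : List (ℝ × ℝ)) (hL : L ≠ []) :
    HasDegree L.length (polyChain 1 L unitTwo) := by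
  obtain ⟨L', e, rfl⟩ : ∃ L' e, L = L' ++ [e] :=
    ⟨L.dropLast, L.getLast hL, (List.dropLast_append_getLast hL).symm⟩
  rw [polyChain_append, polyChain_cons, polyChain_nil, List.length_append, List.length_singleton,
    add_comm]
  exact (hasDegree_polyStep_unitTwo 1 e).polyChain 1 L'

/-- Near `z = 0` the positions and masses enter only through these two sums; this is where the
peakons are read off. -/
theorem low_coeffs_unitTwo (L : List (ℝ × ℝ)) :
    (polyChain 1 L unitTwo 0).coeff 0 = 0 ∧
    (polyChain 1 L unitTwo 0).coeff 1 = -2 * (L.map Prod.snd).sum ∧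
    (polyChain 1 L unitTwo 1).coeff 0 = 1 ∧
    (polyChain 1 L unitTwo 2).coeff 0 = 2 * (L.map Prod.fst).sum := by
  induction L with
  | nil => simp [unitTwo]
  | cons e L ih =>
    obtain ⟨h0, h1, h2, h3⟩ := ih
    refine ⟨?_, ?_, ?_, ?_⟩
    · simp [polyStep, h0]
    · rw [polyChain_cons, coeff_polyStep_zero_succ, h0, h1, h2]
      simp
      ring
    · simp [polyStep, h0, h2]
    · simp [polyStep, h0, h2, h3]
      ring

end Chains

/-! ### From eigenfunctions of the boundary value problem to zeros of `A_N`. -/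

section Spectrum

/-- The gap between consecutive peakons that has exactly the first `k` of them to its left. -/
def gap {N : ℕ} (x : Fin N → ℝ) (k : ℕ) : Set ℝ :=
  {s | ∀ j : Fin N, ((j : ℕ) < k → x j < s) ∧ (k ≤ (j : ℕ) → s < x j)}

theorem gap_eq_iInter {N : ℕ} (x : Fin N → ℝ) (k : ℕ) :
    gap x k = ⋂ j : Fin N, if (j : ℕ) < k then Set.Ioi (x j) else Set.Iio (x j) := by
  ext s
  simp only [gap, Set.mem_ofPred_eq, Set.mem_iInter]
  refine forall_congr' fun j => ?_
  split_ifs with h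
  · simp [h, h.not_ge]
  · simp [h, not_lt.1 h]

theorem isOpen_gap {N : ℕ} (x : Fin N → ℝ) (k : ℕ) : IsOpen (gap x k) := by
  rw [gap_eq_iInter]
  refine isOpen_iInter_of_finite fun j => ?_
  split_ifs
  · exact isOpen_Ioi
  · exact isOpen_Iio

theorem isPreconnected_gap {N : ℕ} (x : Fin N → ℝ) (k : ℕ) : IsPreconnected (gap x k) := by
  refine Set.OrdConnected.isPreconnected ?_
  rw [gap_eq_iInter]
  refine Set.ordConnected_iInter fun j => ?_
  split_ifs
  · exact Set.ordConnected_Ioi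
  · exact Set.ordConnected_Iio

theorem ne_of_mem_gap {N : ℕ} {x : Fin N → ℝ} {k : ℕ} {s : ℝ} (hs : s ∈ gap x k) (j : Fin N) :
    s ≠ x j := by
  rcases lt_or_ge (j : ℕ) k with h | h
  · exact ((hs j).1 h).ne'
  · exact ((hs j).2 h).ne

theorem exists_mem_gap {N : ℕ} {x : Fin N → ℝ} (hx : StrictMono x) {s : ℝ}
    (hs : ∀ j, s ≠ x j) : ∃ k ≤ N, s ∈ gap x k := by
  classical
  have hN : ∃ n : ℕ, ∀ j : Fin N, n ≤ (j : ℕ) → s < x j := ⟨N, fun j hj => by omega⟩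
  refine ⟨Nat.find hN, Nat.find_min' hN fun j hj => by omega,
    fun j => ⟨fun h => ?_, fun h => Nat.find_spec hN j h⟩⟩
  have := Nat.find_min hN h
  push Not at this
  obtain ⟨i, hji, hi⟩ := this
  have h1 : x j ≤ x i := hx.monotone (show j ≤ i from hji)
  have h2 := hs j
  exact lt_of_le_of_ne (h1.trans hi) h2.symm

theorem eventually_gap_left {N : ℕ} {x : Fin N → ℝ} (hx : StrictMono x) (k : Fin N) :
    ∀ᶠ s in 𝓝[<] x k, s ∈ gap x k := by
  have : ∀ᶠ s in 𝓝 (x k), ∀ j : Fin N, j < k → x j < s :=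
    (Filter.eventually_all).2 fun j => by
      by_cases h : j < k
      · filter_upwards [lt_mem_nhds (hx h)] with s hs _ using hs
      · exact Eventually.of_forall fun s hc => absurd hc h
  filter_upwards [self_mem_nhdsWithin, nhdsWithin_le_nhds this] with s hs hs' j
  exact ⟨fun h => hs' j h, fun h => lt_of_lt_of_le hs (hx.monotone h)⟩

theorem eventually_gap_right {N : ℕ} {x : Fin N → ℝ} (hx : StrictMono x) (k : Fin N) :
    ∀ᶠ s in 𝓝[>] x k, s ∈ gap x (k + 1) := by
  have : ∀ᶠ s in 𝓝 (x k), ∀ j : Fin N, k < j → s < x j :=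
    (Filter.eventually_all).2 fun j => by
      by_cases h : k < j
      · filter_upwards [gt_mem_nhds (hx h)] with s hs _ using hs
      · exact Eventually.of_forall fun s hc => absurd hc h
  filter_upwards [self_mem_nhdsWithin, nhdsWithin_le_nhds this] with s hs hs' j
  exact ⟨fun h => lt_of_le_of_lt (hx.monotone (show j ≤ k from Nat.lt_succ_iff.1 h)) hs,
    fun h => hs' j h⟩

theorem eventually_gap_atBot {N : ℕ} (x : Fin N → ℝ) : ∀ᶠ s in atBot, s ∈ gap x 0 := by
  have : ∀ᶠ s in (atBot : Filter ℝ), ∀ j : Fin N, s < x j :=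
    (Filter.eventually_all).2 fun j => eventually_lt_atBot (x j)
  filter_upwards [this] with s hs j
  exact ⟨fun h => absurd h (Nat.not_lt_zero _), fun _ => hs j⟩

theorem eventually_gap_atTop {N : ℕ} (x : Fin N → ℝ) : ∀ᶠ s in atTop, s ∈ gap x N := by
  have : ∀ᶠ s in (atTop : Filter ℝ), ∀ j : Fin N, x j < s :=
    (Filter.eventually_all).2 fun j => eventually_gt_atTop (x j)
  filter_upwards [this] with s hs j
  exact ⟨fun _ => hs j, fun h => absurd j.2 h.not_gt⟩

theorem hasDerivAt_cexp_ofReal (s : ℝ) :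
    HasDerivAt (fun s : ℝ => Complex.exp s) (Complex.exp s) s :=
  (Complex.hasDerivAt_exp (s : ℂ)).comp_ofReal

theorem hasDerivAt_cexp_neg_ofReal (s : ℝ) :
    HasDerivAt (fun s : ℝ => Complex.exp (-s)) (-Complex.exp (-s)) s := by
  have h := (hasDerivAt_neg (s : ℂ)).cexp.comp_ofReal
  simpa using h

theorem cexp_mul_cexp_neg (s : ℂ) : Complex.exp s * Complex.exp (-s) = 1 := by
  rw [← Complex.exp_add]
  simp

/-- The general solution on a gap. -/
theorem exists_coeffs_of_ode {I : Set ℝ} (hI : IsOpen I) (hc : IsPreconnected I) {lam : ℂ}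
    (hlam : lam ≠ 0) {φ₁ φ₂ φ₃ : ℝ → ℂ}
    (h : ∀ s ∈ I, HasDerivAt φ₁ (φ₃ s) s ∧ HasDerivAt φ₂ 0 s ∧ HasDerivAt φ₃ (φ₁ s) s) :
    ∃ a b c : ℂ, ∀ s ∈ I, φ₁ s = a * Complex.exp s + lam ^ 2 * c * Complex.exp (-s) ∧
      φ₂ s = 2 * lam * b ∧ φ₃ s = a * Complex.exp s - lam ^ 2 * c * Complex.exp (-s) := by
  rcases I.eq_empty_or_nonempty with rfl | ⟨s₀, hs₀⟩
  · exact ⟨0, 0, 0, by simp⟩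
  have key : ∀ f : ℝ → ℂ, (∀ s ∈ I, HasDerivAt f 0 s) → ∀ s ∈ I, f s = f s₀ := fun f hf s hs =>
    hI.is_const_of_deriv_eq_zero hc (fun t ht => (hf t ht).differentiableAt.differentiableWithinAt)
      (fun t ht => (hf t ht).deriv) hs hs₀
  have h1 := key (fun s => (φ₁ s + φ₃ s) * Complex.exp (-s)) fun s hs => by
    have := ((h s hs).1.add (h s hs).2.2).mul (hasDerivAt_cexp_neg_ofReal s)
    refine this.congr_deriv ?_
    simp only [Pi.add_apply]
    ring
  have h3 := key (fun s => (φ₁ s - φ₃ s) * Complex.exp s) fun s hs => by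
    have := ((h s hs).1.sub (h s hs).2.2).mul (hasDerivAt_cexp_ofReal s)
    refine this.congr_deriv ?_
    simp only [Pi.sub_apply]
    ring
  have h2 := key φ₂ fun s hs => (h s hs).2.1
  refine ⟨(φ₁ s₀ + φ₃ s₀) * Complex.exp (-s₀) / 2, φ₂ s₀ / (2 * lam),
    (φ₁ s₀ - φ₃ s₀) * Complex.exp s₀ / (2 * lam ^ 2), fun s hs => ?_⟩
  have e := cexp_mul_cexp_neg s
  have h1s := h1 s hs
  have h3s := h3 s hs
  rw [← h1s, ← h3s, h2 s hs]
  refine ⟨?_, ?_, ?_⟩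
  · field_simp
    linear_combination (-2 * φ₁ s) * e
  · field_simp
  · field_simp
    linear_combination (-2 * φ₃ s) * e

theorem tendsto_cexp_coeffs (F : Filter ℝ) (a b : ℂ) (x : ℝ) (hF : F ≤ 𝓝 x) :
    Tendsto (fun s : ℝ => a * Complex.exp s + b * Complex.exp (-s)) F
      (𝓝 (a * Complex.exp x + b * Complex.exp (-x))) := by
  have : Continuous fun s : ℝ => a * Complex.exp s + b * Complex.exp (-s) := by fun_prop
  exact (this.tendsto x).mono_left hF

/-- Solving the jump conditions at one peakon for the coefficients on its right. -/
theorem jump_solve {lam a b c a' b' c' : ℂ} (hlam : lam ≠ 0) {x m : ℝ}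
    (h3 : a' * Complex.exp x - lam ^ 2 * c' * Complex.exp (-x) =
      a * Complex.exp x - lam ^ 2 * c * Complex.exp (-x))
    (h2 : 2 * lam * b' - 2 * lam * b =
      2 * lam * m * (a * Complex.exp x - lam ^ 2 * c * Complex.exp (-x)))
    (h1 : (a' * Complex.exp x + lam ^ 2 * c' * Complex.exp (-x)) -
      (a * Complex.exp x + lam ^ 2 * c * Complex.exp (-x)) =
      2 * lam * m * ((2 * lam * b + 2 * lam * b') / 2)) :
    b' = b + m * (a * Complex.exp x - lam ^ 2 * c * Complex.exp (-x)) ∧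
      a' = a + lam ^ 2 * m * Complex.exp (-x) * (b + b') ∧
      c' = c + m * Complex.exp x * (b + b') := by
  have e := cexp_mul_cexp_neg x
  refine ⟨?_, ?_, ?_⟩
  · refine mul_left_cancel₀ (mul_ne_zero two_ne_zero hlam) ?_
    linear_combination h2
  · linear_combination (a - a') * e + Complex.exp (-x) / 2 * (h1 + h3)
  · refine mul_left_cancel₀ (pow_ne_zero 2 hlam) ?_
    linear_combination lam ^ 2 * (c - c') * e + Complex.exp x / 2 * (h1 - h3)

/-- An eigenvalue is a zero of the first entry of the transferred vector. -/
theorem transferred_eq_zero_of_isEigenvalue {N : ℕ} {x m : Fin N → ℝ} (hx : StrictMono x) {z : ℝ}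
    (hz : z ≠ 0) (hev : IsEigenvalue x m z) (c : ℕ → Fin 3 → ℝ) (hc0 : c 0 = ![1, 0, 0])
    (hc : ∀ k : Fin N, c (k + 1) = (transition (x k) (m k) z).mulVec (c k)) : c N 0 = 0 := by
  obtain ⟨lam, φ₁, φ₂, φ₃, hzl, hsol, ⟨s₁, hs₁, hne⟩, hlim⟩ := hev
  have hlam : lam ≠ 0 := by
    rintro rfl
    exact hz (by simpa using hzl)
  have hsolve : ∀ k, ∃ a b c : ℂ, ∀ s ∈ gap x k,
      φ₁ s = a * Complex.exp s + lam ^ 2 * c * Complex.exp (-s) ∧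
      φ₂ s = 2 * lam * b ∧ φ₃ s = a * Complex.exp s - lam ^ 2 * c * Complex.exp (-s) := fun k =>
    exists_coeffs_of_ode (isOpen_gap x k) (isPreconnected_gap x k) hlam fun s hs =>
      hsol.ode s (ne_of_mem_gap hs)
  choose a b c' hsolve using hsolve
  have hb0 : b 0 = 0 := by
    have h1 : Tendsto φ₂ atBot (𝓝 (2 * lam * b 0)) :=
      tendsto_const_nhds.congr' (by
        filter_upwards [eventually_gap_atBot x] with s hs using (hsolve 0 s hs).2.1.symm)
    have := tendsto_nhds_unique h1 (hlim φ₂ (by simp)).1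
    simpa [hlam] using this
  have hexp0 : Tendsto (fun s : ℝ => Complex.exp s) atBot (𝓝 0) := by
    have := (Complex.continuous_ofReal.tendsto 0).comp Real.tendsto_exp_atBot
    simpa [Function.comp_def] using this
  have hc0' : c' 0 = 0 := by
    -- Multiplication by `e^s` turns the growing term `e^{-s}` into a constant, so decay at `-∞`
    -- forces its coefficient to vanish.
    have h1 : Tendsto (fun s => φ₃ s * Complex.exp s) atBot (𝓝 0) := by
      simpa using (hlim φ₃ (by simp)).1.mul hexp0
    have h2 : Tendsto (fun s : ℝ => a 0 * (Complex.exp s * Complex.exp s) - lam ^ 2 * c' 0) atBot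
        (𝓝 (a 0 * (0 * 0) - lam ^ 2 * c' 0)) :=
      ((hexp0.mul hexp0).const_mul _).sub_const _
    have h3 := tendsto_nhds_unique (h2.congr' (by
      filter_upwards [eventually_gap_atBot x] with s hs
      rw [(hsolve 0 s hs).2.2]
      linear_combination lam ^ 2 * c' 0 * cexp_mul_cexp_neg s)) h1
    simpa [hlam] using h3
  have hstep : ∀ k ≤ N, a k = a 0 * c k 0 ∧ b k = a 0 * c k 1 ∧ c' k = a 0 * c k 2 := by
    intro k
    induction k with
    | zero => simp [hc0, hb0, hc0']
    | succ k ih =>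
      intro hk
      obtain ⟨ha, hb, hcc⟩ := ih (by omega)
      set j : Fin N := ⟨k, by omega⟩ with hj
      obtain ⟨l₁, r₁, l₂, r₂, hl1, hr1, hl2, hr2, hj2, hj1⟩ := hsol.jump j
      have gl := eventually_gap_left hx j
      have gr := eventually_gap_right hx j
      have el1 : l₁ = a k * Complex.exp (x j) + lam ^ 2 * c' k * Complex.exp (-x j) :=
        tendsto_nhds_unique hl1 ((tendsto_cexp_coeffs _ _ _ _ nhdsWithin_le_nhds).congr' (by
          filter_upwards [gl] with s hs using (hsolve k s hs).1.symm))
      have er1 : r₁ = a (k + 1) * Complex.exp (x j) +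
          lam ^ 2 * c' (k + 1) * Complex.exp (-x j) :=
        tendsto_nhds_unique hr1 ((tendsto_cexp_coeffs _ _ _ _ nhdsWithin_le_nhds).congr' (by
          filter_upwards [gr] with s hs using (hsolve (k + 1) s hs).1.symm))
      have el2 : l₂ = 2 * lam * b k :=
        tendsto_nhds_unique hl2 (tendsto_const_nhds.congr' (by
          filter_upwards [gl] with s hs using (hsolve k s hs).2.1.symm))
      have er2 : r₂ = 2 * lam * b (k + 1) :=
        tendsto_nhds_unique hr2 (tendsto_const_nhds.congr' (by
          filter_upwards [gr] with s hs using (hsolve (k + 1) s hs).2.1.symm))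
      have el3 : φ₃ (x j) = a k * Complex.exp (x j) - lam ^ 2 * c' k * Complex.exp (-x j) := by
        rw [sub_eq_add_neg, ← neg_mul]
        exact tendsto_nhds_unique
          ((hsol.continuous_third.tendsto (x j)).mono_left nhdsWithin_le_nhds)
          ((tendsto_cexp_coeffs (𝓝[<] x j) _ _ _ nhdsWithin_le_nhds).congr' (by
            filter_upwards [gl] with s hs
            rw [(hsolve k s hs).2.2]
            ring))
      have er3 : φ₃ (x j) = a (k + 1) * Complex.exp (x j) -
          lam ^ 2 * c' (k + 1) * Complex.exp (-x j) := by
        rw [sub_eq_add_neg, ← neg_mul]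
        exact tendsto_nhds_unique
          ((hsol.continuous_third.tendsto (x j)).mono_left nhdsWithin_le_nhds)
          ((tendsto_cexp_coeffs (𝓝[>] x j) _ _ _ nhdsWithin_le_nhds).congr' (by
            filter_upwards [gr] with s hs
            rw [(hsolve (k + 1) s hs).2.2]
            ring))
      rw [er2, el2, el3] at hj2
      rw [er1, el1, el2, er2] at hj1
      obtain ⟨hb', ha', hc'⟩ := jump_solve hlam (er3.symm.trans el3) hj2 hj1
      have hck := hc j
      simp only [hj] at hck
      have e := cexp_mul_cexp_neg (x j)
      rw [hck, transition_eq, ← hj]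
      rw [hb'] at ha' hc'
      simp only [transitionPair, Matrix.mulVec, dotProduct, Fin.sum_univ_three]
      simp
      rw [ha', hc', hb', hzl, ha, hb, hcc]
      refine ⟨?_, ?_, ?_⟩
      · ring
      · ring
      · ring
  -- To the right of all peakons the derivative of `φ₃` is `φ₁`, and `φ₁ e^{-s}` tends to `a N`.
  have haN : a 0 * c N 0 = 0 := by
    have h1 : Tendsto (deriv φ₃) atTop (𝓝 0) := (hlim φ₃ (by simp)).2.2
    have hexpn : Tendsto (fun s : ℝ => Complex.exp (-s)) atTop (𝓝 0) := by
      have := hexp0.comp tendsto_neg_atTop_atBot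
      simpa [Function.comp_def] using this
    have h2 : Tendsto (fun s => deriv φ₃ s * Complex.exp (-s)) atTop (𝓝 0) := by
      simpa using h1.mul hexpn
    have h3 : Tendsto (fun s : ℝ => a N +
        lam ^ 2 * c' N * (Complex.exp (-s) * Complex.exp (-s))) atTop
        (𝓝 (a N + lam ^ 2 * c' N * (0 * 0))) :=
      ((hexpn.mul hexpn).const_mul _).const_add _
    have h4 := tendsto_nhds_unique (h3.congr' (by
      filter_upwards [eventually_gap_atTop x] with s hs
      rw [(hsol.ode s (ne_of_mem_gap hs)).2.2.deriv, (hsolve N s hs).1]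
      linear_combination -a N * cexp_mul_cexp_neg s)) h2
    rw [← (hstep N le_rfl).1]
    simpa using h4
  -- If `a 0 = 0`, the coefficients vanish on every gap, and the solution is zero away from the
  -- peakons.
  rcases mul_eq_zero.1 haN with h | h
  · exfalso
    obtain ⟨k, hk, hsk⟩ := exists_mem_gap hx hs₁
    obtain ⟨e1, e2, e3⟩ := hstep k hk
    obtain ⟨f1, f2, f3⟩ := hsolve k s₁ hsk
    rw [e1, e3, h] at f1 f3
    rw [e2, h] at f2
    simp at f1 f2 f3
    simp [f1, f2, f3] at hne
  · exact_mod_cast h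

end Spectrum

/-! ### Partial fractions over the spectrum, and orthogonality of the second column. -/

section Data

open Polynomial Lagrange

/-- The pairs `(m_i e^{x_i}, m_i e^{-x_i})` from right to left. -/
def pairList {N : ℕ} (x m : Fin N → ℝ) : List (ℝ × ℝ) :=
  List.ofFn fun i : Fin N =>
    (m i.rev * Real.exp (x i.rev), m i.rev * Real.exp (-x i.rev))

theorem length_pairList {N : ℕ} (x m : Fin N → ℝ) : (pairList x m).length = N := by
  simp [pairList]

theorem partialTransition_eq {N : ℕ} (x m : Fin N → ℝ) (k : ℕ) (z : ℝ) :
    partialTransition x m k z = (((pairList x m).take k).map (transitionPair z)).prod := by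
  rw [partialTransition, pairList, List.map_take, List.map_ofFn]
  congr 3
  funext i
  exact transition_eq _ _ _

theorem eval_unitOne (z : ℝ) : (fun i => (unitOne i).eval z) = ![1, 0, 0] := by
  funext i
  fin_cases i <;> simp [unitOne]

theorem eval_unitTwo (z : ℝ) : (fun i => (unitTwo i).eval z) = ![0, 1, 0] := by
  funext i
  fin_cases i <;> simp [unitTwo]

theorem partialTransition_col {N : ℕ} (x m : Fin N → ℝ) (k : ℕ) (z : ℝ) :
    (partialTransition x m k z).col 1 =
      fun i => (polyChain 1 ((pairList x m).take k) unitTwo i).eval z := by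
  rw [eval_polyChain, partialTransition_eq, eval_unitTwo]
  funext i
  simp [Matrix.mulVec, dotProduct, Fin.sum_univ_three]

theorem coeffs_eq {N : ℕ} (x m : Fin N → ℝ) (z : ℝ) :
    coeffs x m z = fun i => (polyChain 1 (pairList x m) unitOne i).eval z := by
  rw [eval_polyChain, coeffs, partialTransition_eq, eval_unitOne, List.take_of_length_le]
  rw [length_pairList]

theorem pairwise_pairList {N : ℕ} {x m : Fin N → ℝ} (hx : StrictMono x) (hm : ∀ k, 0 < m k) :
    (pairList x m).Pairwise fun a b => b.1 * a.2 < a.1 * b.2 := by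
  rw [pairList, List.pairwise_ofFn]
  intro i j hij
  have hlt : x j.rev < x i.rev := hx (Fin.rev_lt_rev.2 hij)
  have h1 : Real.exp (x j.rev) < Real.exp (x i.rev) := Real.exp_lt_exp.2 hlt
  have h2 : Real.exp (-x i.rev) < Real.exp (-x j.rev) := Real.exp_lt_exp.2 (by linarith)
  have h3 := mul_lt_mul'' h1 h2 (Real.exp_pos _).le (Real.exp_pos _).le
  have h4 := mul_lt_mul_of_pos_left h3 (mul_pos (hm i.rev) (hm j.rev))
  simp only
  linarith

theorem pairList_pos {N : ℕ} {x m : Fin N → ℝ} (hm : ∀ k, 0 < m k) :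
    ∀ e ∈ pairList x m, 0 < e.2 ∧ 0 < e.1 := by
  intro e he
  rw [pairList, List.mem_ofFn] at he
  obtain ⟨i, rfl⟩ := he
  exact ⟨mul_pos (hm _) (Real.exp_pos _), mul_pos (hm _) (Real.exp_pos _)⟩

theorem coeffs_eq_zero_of_isEigenvalue {N : ℕ} {x m : Fin N → ℝ} (hx : StrictMono x) {z : ℝ}
    (hz : z ≠ 0) (hev : IsEigenvalue x m z) : coeffs x m z 0 = 0 := by
  have := transferred_eq_zero_of_isEigenvalue hx hz hev
    (fun k i => (polyChain 1 ((pairList x m).drop (N - k)) unitOne i).eval z)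
    (by
      rw [Nat.sub_zero, List.drop_of_length_le (length_pairList x m).le]
      exact eval_unitOne z)
    (fun k => by
      have hlt : N - (k + 1) < (pairList x m).length := by
        rw [length_pairList]
        omega
      have hd : (pairList x m).drop (N - (k + 1)) =
          (pairList x m)[N - (k + 1)] :: (pairList x m).drop (N - k) := by
        rw [List.drop_eq_getElem_cons hlt]
        congr 2
        omega
      have hg : (pairList x m)[N - (k + 1)] =
          (m k * Real.exp (x k), m k * Real.exp (-x k)) := by
        have hrev : Fin.rev (⟨N - (k + 1), by omega⟩ : Fin N) = k := by
          ext
          simp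
          omega
        simp only [pairList, List.getElem_ofFn, hrev]
      rw [hd, polyChain_cons, eval_polyStep, hg, transition_eq])
  rw [coeffs_eq]
  simpa using this

/-- Peakons together with their spectral data. -/
structure PeakonData {N : ℕ} (x m ζ b : Fin N → ℝ) : Prop where
  strictMono_pos : StrictMono x
  mass_pos : ∀ k, 0 < m k
  strictMono_eig : StrictMono ζ
  eig_pos : ∀ j, 0 < ζ j
  res_pos : ∀ j, 0 < b j
  data : IsSpectralData x m ζ b

/-- The polynomials `(A_N, B_N, C_N)`. -/
def fullVec {N : ℕ} (x m : Fin N → ℝ) : Fin 3 → ℝ[X] := polyChain 1 (pairList x m) unitOne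

/-- The second column of the partial transition matrix. -/
def colVec {N : ℕ} (x m : Fin N → ℝ) (k : ℕ) : Fin 3 → ℝ[X] :=
  polyChain 1 ((pairList x m).take k) unitTwo

/-- The coefficients to the right of the first `N - k` peakons. -/
def innerVec {N : ℕ} (x m : Fin N → ℝ) (k : ℕ) : Fin 3 → ℝ[X] :=
  polyChain 1 ((pairList x m).drop k) unitOne

theorem fullVec_eq {N : ℕ} (x m : Fin N → ℝ) (k : ℕ) :
    fullVec x m = polyChain 1 ((pairList x m).take k) (innerVec x m k) := by
  rw [innerVec, ← polyChain_append, List.take_append_drop, fullVec]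

theorem hasDegree_fullVec {N : ℕ} (x m : Fin N → ℝ) : HasDegree N (fullVec x m) := by
  have := hasDegree_unitOne.polyChain 1 (pairList x m)
  rwa [length_pairList, zero_add] at this

theorem hasDegree_innerVec {N : ℕ} (x m : Fin N → ℝ) (k : ℕ) :
    HasDegree (N - k) (innerVec x m k) := by
  have := hasDegree_unitOne.polyChain 1 ((pairList x m).drop k)
  rwa [List.length_drop, length_pairList, zero_add] at this

/-- Multiplying the entries would only give degree `N + k`. But the minors are the transport, by `k`
steps, of the minors `(A, 0, -C)` of the inner vector with `unitTwo`, which have degree at most `N -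
k`. -/
theorem hasDegree_minors {N : ℕ} (x m : Fin N → ℝ) {k : ℕ} (hk : k ≤ N) :
    HasDegree N (minors (fullVec x m) (colVec x m k)) := by
  rw [fullVec_eq x m k, colVec, minors_polyChain]
  have h0 : HasDegree (N - k) (minors (innerVec x m k) unitTwo) := by
    have h := hasDegree_innerVec x m k
    exact ⟨fun i hi => by simpa [minors, unitTwo] using h.fst i hi,
      fun i hi => by simp [minors, unitTwo],
      fun i hi => by simpa [minors, unitTwo] using h.trd i hi⟩
  have := h0.polyChain (-1) ((pairList x m).take k)
  rwa [List.length_take, length_pairList, min_eq_left hk, Nat.sub_add_cancel hk] at this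

theorem coeff_zero_polyChain_unitOne (L : List (ℝ × ℝ)) :
    (polyChain 1 L unitOne 0).coeff 0 = 1 := by
  induction L with
  | nil => simp [unitOne]
  | cons e L ih => simp [polyStep, ih]

theorem degree_lt_of_coeff {p : ℝ[X]} {n : ℕ} (h : ∀ i, n ≤ i → p.coeff i = 0) :
    p.degree < n := by
  rw [degree_lt_iff_coeff_zero]
  exact h

namespace PeakonData

variable {N : ℕ} {x m ζ b : Fin N → ℝ}

/-- The leading coefficient of `A_N`. -/
def lead (x m : Fin N → ℝ) : ℝ := (fullVec x m 0).coeff N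

theorem injOn (h : PeakonData x m ζ b) : Set.InjOn ζ (Finset.univ : Finset (Fin N)) :=
  h.strictMono_eig.injective.injOn

/-- The difference has degree below `N` and `N` distinct zeros. Only the implication from
eigenvalues to zeros of `A_N` is needed, since the number of eigenvalues is given. -/
theorem fullVec_zero_eq (h : PeakonData x m ζ b) :
    fullVec x m 0 = C (lead x m) * nodal Finset.univ ζ := by
  rw [← sub_eq_zero]
  refine eq_zero_of_degree_lt_of_eval_index_eq_zero _ h.injOn ?_ fun i _ => ?_
  · rw [Finset.card_univ, Fintype.card_fin]
    refine degree_lt_of_coeff fun i hi => ?_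
    rcases hi.eq_or_lt with rfl | hi
    · have : (nodal Finset.univ ζ).coeff N = 1 := by
        have := (nodal_monic (s := Finset.univ) (v := ζ)).coeff_natDegree
        rwa [natDegree_nodal, Finset.card_univ, Fintype.card_fin] at this
      simp [lead, this]
    · have h1 : (nodal Finset.univ ζ).coeff i = 0 := by
        refine coeff_eq_zero_of_natDegree_lt ?_
        rwa [natDegree_nodal, Finset.card_univ, Fintype.card_fin]
      simp [(hasDegree_fullVec x m).fst i hi, h1]
  · have hev : IsEigenvalue x m ((ζ i : ℝ) : ℂ) := by
      have : ((ζ i : ℝ) : ℂ) ∈ {z : ℂ | IsEigenvalue x m z} := by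
        rw [h.data.spectrum]
        exact ⟨i, rfl⟩
      exact this
    have h1 := coeffs_eq_zero_of_isEigenvalue h.strictMono_pos (h.eig_pos i).ne' hev
    rw [coeffs_eq] at h1
    have h2 : eval (ζ i) (fullVec x m 0) = 0 := h1
    rw [eval_sub, h2, eval_mul, eval_nodal_at_node (Finset.mem_univ i)]
    simp

theorem eval_zero_fullVec (x m : Fin N → ℝ) : (fullVec x m 0).eval 0 = 1 := by
  rw [← coeff_zero_eq_eval_zero]
  exact coeff_zero_polyChain_unitOne _

theorem lead_ne_zero (h : PeakonData x m ζ b) : lead x m ≠ 0 := by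
  intro h0
  have := eval_zero_fullVec x m
  rw [h.fullVec_zero_eq, h0] at this
  simp at this

theorem eval_nodal_ne (h : PeakonData x m ζ b) {z : ℝ} (hz : ∀ j, z ≠ ζ j) :
    (fullVec x m 0).eval z ≠ 0 := by
  rw [h.fullVec_zero_eq, eval_mul, eval_C]
  exact mul_ne_zero h.lead_ne_zero (eval_nodal_not_at_node fun i _ => hz i)

theorem eval_at_eig (h : PeakonData x m ζ b) (j : Fin N) : (fullVec x m 0).eval (ζ j) = 0 := by
  rw [h.fullVec_zero_eq, eval_mul, eval_nodal_at_node (Finset.mem_univ j), mul_zero]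

/-- The partial fraction decomposition of `p / A_N`. -/
theorem partial_fraction (h : PeakonData x m ζ b) {p : ℝ[X]} (hp : ∀ i, N ≤ i → p.coeff i = 0)
    {z : ℝ} (hz : ∀ j, z ≠ ζ j) :
    p.eval z = (fullVec x m 0).eval z *
      ∑ l, nodalWeight Finset.univ ζ l / lead x m * p.eval (ζ l) / (z - ζ l) := by
  have h1 := eq_interpolate (s := Finset.univ) h.injOn (f := p) (by
    rw [Finset.card_univ, Fintype.card_fin]
    exact degree_lt_of_coeff hp)
  conv_lhs => rw [h1]
  rw [eval_interpolate_not_at_node _ fun i _ => hz i, h.fullVec_zero_eq, eval_mul, eval_C,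
    mul_comm (lead x m), mul_assoc, Finset.mul_sum (a := lead x m)]
  congr 1
  refine Finset.sum_congr rfl fun l _ => ?_
  have := h.lead_ne_zero
  field_simp

/-- The residues of the Weyl function. -/
theorem residue_eq (h : PeakonData x m ζ b) (j : Fin N) :
    nodalWeight Finset.univ ζ j / lead x m * (fullVec x m 1).eval (ζ j) = -b j := by
  set E := nodal (Finset.univ.erase j) ζ with hE
  have hE0 : E.eval (ζ j) ≠ 0 := eval_nodal_not_at_node fun i hi hc =>
    (Finset.ne_of_mem_erase hi) (h.strictMono_eig.injective hc).symm
  have hlead := h.lead_ne_zero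
  have h1 : Tendsto (fun z : ℝ => -(fullVec x m 1).eval z / (lead x m * E.eval z)) (𝓝[≠] ζ j)
      (𝓝 (-(fullVec x m 1).eval (ζ j) / (lead x m * E.eval (ζ j)))) := by
    refine Tendsto.mono_left ?_ nhdsWithin_le_nhds
    refine ContinuousAt.div ?_ ?_ (mul_ne_zero hlead hE0)
    · exact (fullVec x m 1).continuous.neg.continuousAt
    · exact (continuous_const.mul E.continuous).continuousAt
  have h2 : (fun z : ℝ => (z - ζ j) * weyl x m z) =ᶠ[𝓝[≠] ζ j]
      fun z : ℝ => -(fullVec x m 1).eval z / (lead x m * E.eval z) := by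
    filter_upwards [self_mem_nhdsWithin] with z hz
    have hz' : z - ζ j ≠ 0 := sub_ne_zero.2 hz
    have h3 : (fullVec x m 0).eval z = (z - ζ j) * (lead x m * E.eval z) := by
      rw [h.fullVec_zero_eq, nodal_eq_mul_nodal_erase (Finset.mem_univ j)]
      simp [hE]
      ring
    have h4 : weyl x m z = -(fullVec x m 1).eval z / (fullVec x m 0).eval z := by
      rw [weyl, coeffs_eq]
      rfl
    rw [h4, h3, ← mul_div_assoc, mul_div_mul_left _ _ hz']
  have h5 := tendsto_nhds_unique (h1.congr' h2.symm) (h.data.residue j)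
  rw [← h5, nodalWeight_eq_eval_nodal_erase_inv, ← hE]
  field_simp

/-- The Cauchy transform `∑ b_i / (y + ζ_i)`. -/
def cauchySum (ζ b : Fin N → ℝ) (y : ℝ) : ℝ := ∑ i, b i / (y + ζ i)

theorem eval_fullVec_one (h : PeakonData x m ζ b) {z : ℝ} (hz : ∀ j, z ≠ ζ j) :
    (fullVec x m 1).eval z = -(fullVec x m 0).eval z * ∑ l, b l / (z - ζ l) := by
  rw [h.partial_fraction (hasDegree_fullVec x m).snd hz]
  simp only [h.residue_eq, neg_div, Finset.sum_neg_distrib]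
  ring

theorem neg_eig_ne (h : PeakonData x m ζ b) (j l : Fin N) : -ζ j ≠ ζ l := by
  have := h.eig_pos j
  have := h.eig_pos l
  intro hc
  linarith

/-- The vector `(1, 0, 0)` is isotropic, so `A_N(-ζ_j) C_N(ζ_j) = 2 B_N(-ζ_j) B_N(ζ_j)`. As `-ζ_j`
is negative it is not an eigenvalue, and `B_N / A_N` there is the Cauchy sum. -/
theorem eval_fullVec_two_at_eig (h : PeakonData x m ζ b) (j : Fin N) :
    (fullVec x m 2).eval (ζ j) = 2 * (fullVec x m 1).eval (ζ j) * cauchySum ζ b (ζ j) := by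
  have h1 := pairing_polyChain (pairList x m) unitOne unitOne (ζ j)
  rw [eval_unitOne, eval_unitOne] at h1
  have h2 : pairing (fun i => (fullVec x m i).eval (-ζ j)) (fun i => (fullVec x m i).eval (ζ j)) =
    pairing ![1, 0, 0] ![1, 0, 0] := h1
  simp only [pairing, h.eval_at_eig, h.eval_fullVec_one (h.neg_eig_ne j)] at h2
  have h3 : ∑ l, b l / (-ζ j - ζ l) = -cauchySum ζ b (ζ j) := by
    rw [cauchySum, ← Finset.sum_neg_distrib]
    refine Finset.sum_congr rfl fun l _ => ?_
    rw [← div_neg]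
    congr 1
    ring
  rw [h3] at h2
  simp at h2
  refine mul_left_cancel₀ (h.eval_nodal_ne (h.neg_eig_ne j)) ?_
  linear_combination h2

/-- The value at infinity of `P - Q W`. -/
def asymp (x m : Fin N → ℝ) (k : ℕ) : ℝ :=
  (minors (fullVec x m) (colVec x m k) 0).coeff N / lead x m

theorem minor_partial_fraction (h : PeakonData x m ζ b) {k : ℕ} (hk : k ≤ N) {z : ℝ}
    (hz : ∀ j, z ≠ ζ j) :
    (minors (fullVec x m) (colVec x m k) 0).eval z = (fullVec x m 0).eval z *
      (asymp x m k + ∑ l, b l * (colVec x m k 0).eval (ζ l) / (z - ζ l)) := by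
  set H := minors (fullVec x m) (colVec x m k) 0 with hH
  have hlead := h.lead_ne_zero
  have hHdeg := (hasDegree_minors x m hk).fst
  -- Removing the value at infinity brings the degree below `N`; at the nodes nothing changes, since
  -- `A_N` vanishes there.
  have h1 := h.partial_fraction (p := H - C (asymp x m k) * fullVec x m 0) (fun i hi => by
    rcases hi.eq_or_lt with rfl | hi
    · simp only [coeff_sub, coeff_C_mul]
      change H.coeff N - H.coeff N / lead x m * lead x m = 0
      field_simp
      ring
    · simp only [coeff_sub, coeff_C_mul, (hasDegree_fullVec x m).fst i hi]
      rw [hHdeg i hi]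
      ring) hz
  have h2 : ∀ l, nodalWeight Finset.univ ζ l / lead x m *
      (H - C (asymp x m k) * fullVec x m 0).eval (ζ l) = b l * (colVec x m k 0).eval (ζ l) := by
    intro l
    have := h.residue_eq l
    simp only [hH, minors, Matrix.cons_val_zero, eval_sub, eval_mul, h.eval_at_eig, eval_C]
    linear_combination (-(colVec x m k 0).eval (ζ l)) * this
  simp only [h2] at h1
  rw [eval_sub, eval_mul, eval_C] at h1
  linear_combination h1

theorem eval_colVec_one (h : PeakonData x m ζ b) {k : ℕ} (hk : k ≤ N) {z : ℝ}
    (hz : ∀ j, z ≠ ζ j) :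
    (colVec x m k 1).eval z = asymp x m k +
      ∑ l, b l * (((colVec x m k 0).eval (ζ l) - (colVec x m k 0).eval z) / (z - ζ l)) := by
  have h1 := h.minor_partial_fraction hk hz
  simp only [minors, Matrix.cons_val_zero, eval_sub, eval_mul, h.eval_fullVec_one hz] at h1
  refine mul_left_cancel₀ (h.eval_nodal_ne hz) ?_
  have h2 : ∑ l, b l * (((colVec x m k 0).eval (ζ l) - (colVec x m k 0).eval z) / (z - ζ l)) =
      ∑ l, b l * (colVec x m k 0).eval (ζ l) / (z - ζ l) -
        (∑ l, b l / (z - ζ l)) * (colVec x m k 0).eval z := by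
    rw [Finset.sum_mul, ← Finset.sum_sub_distrib]
    refine Finset.sum_congr rfl fun l _ => by ring
  rw [h2]
  linear_combination h1

/-- The middle minor `(A_N u_2 - C_N u_0) / 2` and `C_N` both have degree below `N`. Their partial
fractions have no constant term, and solving for `u_2` gives the formula. -/
theorem eval_colVec_two (h : PeakonData x m ζ b) {k : ℕ} (hk : k ≤ N) {z : ℝ}
    (hz : ∀ j, z ≠ ζ j) :
    (colVec x m k 2).eval z = 2 * ∑ l, b l * cauchySum ζ b (ζ l) *
      (((colVec x m k 0).eval (ζ l) - (colVec x m k 0).eval z) / (z - ζ l)) := by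
  have h1 := h.partial_fraction (hasDegree_minors x m hk).snd hz
  have h2 := h.partial_fraction (hasDegree_fullVec x m).trd hz
  have h3 : ∀ l, nodalWeight Finset.univ ζ l / lead x m *
      (minors (fullVec x m) (colVec x m k) 1).eval (ζ l) =
        b l * cauchySum ζ b (ζ l) * (colVec x m k 0).eval (ζ l) := by
    intro l
    have := h.residue_eq l
    simp only [minors, Matrix.cons_val_one, Matrix.cons_val_zero, eval_sub, eval_mul,
      h.eval_at_eig, eval_C, h.eval_fullVec_two_at_eig]
    linear_combination (-cauchySum ζ b (ζ l) * (colVec x m k 0).eval (ζ l)) * this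
  have h4 : ∀ l, nodalWeight Finset.univ ζ l / lead x m * (fullVec x m 2).eval (ζ l) =
        -2 * (b l * cauchySum ζ b (ζ l)) := by
    intro l
    have := h.residue_eq l
    rw [h.eval_fullVec_two_at_eig]
    linear_combination 2 * cauchySum ζ b (ζ l) * this
  simp only [h3] at h1
  simp only [h4] at h2
  refine mul_left_cancel₀ (h.eval_nodal_ne hz) ?_
  have h5 : 2 * ∑ l, b l * cauchySum ζ b (ζ l) *
      (((colVec x m k 0).eval (ζ l) - (colVec x m k 0).eval z) / (z - ζ l)) =
      2 * (∑ l, b l * cauchySum ζ b (ζ l) * (colVec x m k 0).eval (ζ l) / (z - ζ l)) +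
        (∑ l, -2 * (b l * cauchySum ζ b (ζ l)) / (z - ζ l)) * (colVec x m k 0).eval z := by
    rw [Finset.sum_mul, Finset.mul_sum, Finset.mul_sum, ← Finset.sum_add_distrib]
    refine Finset.sum_congr rfl fun l _ => by ring
  rw [h5]
  simp only [minors, Matrix.cons_val_one, Matrix.cons_val_zero, eval_sub, eval_mul, eval_C] at h1
  linear_combination 2 * h1 + (colVec x m k 0).eval z * h2

/-- The invariant form of the second column at `-ζ_j` with `v(ζ_j)` equals that of `(0, 1, 0)` with
the inner vector, which is `-2 w_1(ζ_j)`. The terms with `u_0(-ζ_j)` cancel because of the formula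
for `C_N(ζ_j)`. -/
theorem inner_at_eig (h : PeakonData x m ζ b) {k : ℕ} (hk : k ≤ N) (j : Fin N) :
    (fullVec x m 1).eval (ζ j) *
      (asymp x m k - ∑ l, b l * (colVec x m k 0).eval (ζ l) / (ζ j + ζ l)) =
        (innerVec x m k 1).eval (ζ j) := by
  have h1 := pairing_polyChain ((pairList x m).take k) unitTwo (innerVec x m k) (ζ j)
  rw [← fullVec_eq, eval_unitTwo] at h1
  change pairing (fun i => (colVec x m k i).eval (-ζ j)) (fun i => (fullVec x m i).eval (ζ j)) = _
    at h1
  simp only [pairing, h.eval_at_eig, h.eval_fullVec_two_at_eig,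
    h.eval_colVec_one hk (h.neg_eig_ne j)] at h1
  have h2 : ∑ l, b l * (((colVec x m k 0).eval (ζ l) - (colVec x m k 0).eval (-ζ j)) /
      (-ζ j - ζ l)) = cauchySum ζ b (ζ j) * (colVec x m k 0).eval (-ζ j) -
        ∑ l, b l * (colVec x m k 0).eval (ζ l) / (ζ j + ζ l) := by
    rw [cauchySum, Finset.sum_mul, ← Finset.sum_sub_distrib]
    refine Finset.sum_congr rfl fun l _ => ?_
    rw [show -ζ j - ζ l = -(ζ j + ζ l) by ring, div_neg]
    ring
  rw [h2] at h1
  simp at h1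
  linear_combination (-1 / 2) * h1

theorem orthogonality (h : PeakonData x m ζ b) {k : ℕ} (hk : k ≤ N) {i : ℕ} (hi : i < k) :
    ∑ j, b j * ζ j ^ i *
      (asymp x m k - ∑ l, b l * (colVec x m k 0).eval (ζ l) / (ζ j + ζ l)) = 0 := by
  have hdeg : ∀ n, N - 1 ≤ n → (X ^ i * innerVec x m k 1).coeff n = 0 := by
    intro n hn
    rw [coeff_X_pow_mul']
    split_ifs
    · exact (hasDegree_innerVec x m k).snd _ (by omega)
    · rfl
  -- The coefficient of order `N - 1` in Lagrange interpolation is the sum of residues; it vanishes,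
  -- since `i < k` keeps the degree at most `N - 2`.
  have h1 := coeff_eq_sum (s := Finset.univ) h.injOn (P := X ^ i * innerVec x m k 1) (by
    rw [Finset.card_univ, Fintype.card_fin]
    exact degree_lt_of_coeff fun n hn => hdeg n (by omega))
  rw [Finset.card_univ, Fintype.card_fin, hdeg _ le_rfl] at h1
  have h2 : ∀ j, b j * ζ j ^ i *
      (asymp x m k - ∑ l, b l * (colVec x m k 0).eval (ζ l) / (ζ j + ζ l)) =
      -(1 / lead x m) * ((X ^ i * innerVec x m k 1).eval (ζ j) /
        ∏ l ∈ Finset.univ.erase j, (ζ j - ζ l)) := by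
    intro j
    have hr := h.residue_eq j
    rw [eval_mul, ← h.inner_at_eig hk j, div_eq_mul_inv _ (∏ l ∈ Finset.univ.erase j, _),
      ← Finset.prod_inv_distrib]
    rw [nodalWeight] at hr
    simp only [eval_pow, eval_X]
    rw [← neg_eq_iff_eq_neg] at hr
    rw [← hr]
    ring
  rw [Finset.sum_congr rfl fun j _ => h2 j, ← Finset.mul_sum, ← h1, mul_zero]

/-- Evaluation at `z = 0`, where `A_N = 1`, `u_0 = 0` and `u_1 = 1`. -/
theorem asymp_eq (h : PeakonData x m ζ b) {k : ℕ} (hk : k ≤ N) :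
    asymp x m k = 1 + ∑ l, b l * (colVec x m k 0).eval (ζ l) / ζ l := by
  have h1 := h.minor_partial_fraction hk (z := 0) fun j => (h.eig_pos j).ne
  obtain ⟨l0, -, l1, -⟩ := low_coeffs_unitTwo ((pairList x m).take k)
  rw [coeff_zero_eq_eval_zero] at l0 l1
  have e0 : (colVec x m k 0).eval 0 = 0 := l0
  have e1 : (colVec x m k 1).eval 0 = 1 := l1
  simp only [minors, Matrix.cons_val_zero, eval_sub, eval_mul, e0, e1, eval_zero_fullVec] at h1
  have h2 : ∑ l, b l * (colVec x m k 0).eval (ζ l) / (0 - ζ l) =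
      -∑ l, b l * (colVec x m k 0).eval (ζ l) / ζ l := by
    rw [← Finset.sum_neg_distrib]
    refine Finset.sum_congr rfl fun l _ => ?_
    rw [zero_sub, div_neg]
  rw [h2] at h1
  linarith

/-- The top coefficient of `A_N` has sign `(-1)^N`. That of the minor has sign `(-1)^(N-k)`: the
inner peakons alternate signs, while the outer `k` steps act at `-z` and preserve the sign. -/
theorem asymp_sign (h : PeakonData x m ζ b) {k : ℕ} (hk : k ≤ N) :
    0 < (-1) ^ k * asymp x m k := by
  have hpw := pairwise_pairList h.strictMono_pos h.mass_pos
  have hpos := pairList_pos (x := x) h.mass_pos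
  have hstart : (X * unitOne 2).coeff 0 = -1 * 0 * (unitOne 0).coeff 0 := by simp [unitOne]
  obtain ⟨κ₁, hκ₁, -, a1, -, -⟩ := leading_polyChain (ε := 1) (by norm_num) hasDegree_unitOne
    hstart (pairList x m) hpw fun e he => ⟨(hpos e he).1, by simpa using (hpos e he).2⟩
  have hpw2 := hpw
  rw [← List.take_append_drop k (pairList x m), List.pairwise_append] at hpw2
  have hdrop : ∀ e ∈ (pairList x m).drop k, e ∈ pairList x m := fun e he => List.mem_of_mem_drop he
  have htake : ∀ e ∈ (pairList x m).take k, e ∈ pairList x m := fun e he => List.mem_of_mem_take he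
  obtain ⟨κ₂, hκ₂, t, b1, b2, b3⟩ := leading_polyChain (ε := 1) (by norm_num) hasDegree_unitOne
    hstart ((pairList x m).drop k) hpw2.2.1 fun e he =>
      ⟨(hpos e (hdrop e he)).1, by simpa using (hpos e (hdrop e he)).2⟩
  have hlen : 0 + ((pairList x m).drop k).length = N - k := by
    rw [List.length_drop, length_pairList, zero_add]
  rw [hlen] at b1 b2
  have hdeg : HasDegree (N - k) (minors (innerVec x m k) unitTwo) := by
    have h := hasDegree_innerVec x m k
    exact ⟨fun i hi => by simpa [minors, unitTwo] using h.fst i hi,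
      fun i hi => by simp [minors, unitTwo],
      fun i hi => by simpa [minors, unitTwo] using h.trd i hi⟩
  -- The initial minors are `(A, 0, -C)`: the sign of the third entry matches `ε = -1`, so the ratio
  -- `t` left by the inner chain continues unchanged.
  obtain ⟨κ₃, hκ₃, -, c1, -, -⟩ := leading_polyChain (ε := -1) (by norm_num) hdeg (t₀ := t) (by
      have e2 : X * minors (innerVec x m k) unitTwo 2 = -(X * innerVec x m k 2) := by
        simp [minors, unitTwo]
      have e0 : minors (innerVec x m k) unitTwo 0 = innerVec x m k 0 := by
        simp [minors, unitTwo]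
      rw [e2, e0, coeff_neg]
      have : (X * innerVec x m k 2).coeff (N - k) = -1 * t * (innerVec x m k 0).coeff (N - k) := b2
      rw [this]
      ring) ((pairList x m).take k) hpw2.1 fun e he => by
        have hp := hpos e (htake e he)
        exact ⟨hp.1, b3 e hp.1 (by simpa using hp.2) fun b' hb' => hpw2.2.2 e he b' hb'⟩
  rw [← minors_polyChain, ← fullVec_eq, List.length_take, length_pairList, min_eq_left hk,
    Nat.sub_add_cancel hk] at c1
  rw [length_pairList, zero_add] at a1
  have hu : (unitOne 0).coeff 0 = 1 := by simp [unitOne]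
  have hlead : lead x m = (-1) ^ N * κ₁ := by
    rw [lead, fullVec, a1, hu, mul_one]
  have hlen2 : ((pairList x m).drop k).length = N - k := by
    rw [List.length_drop, length_pairList]
  have hm0 : (minors (innerVec x m k) unitTwo 0).coeff (N - k) = (-1) ^ (N - k) * κ₂ := by
    have e0 : minors (innerVec x m k) unitTwo 0 = innerVec x m k 0 := by
      simp [minors, unitTwo]
    rw [e0, innerVec, b1, hu, mul_one, hlen2]
  rw [hm0] at c1
  have hnum : (minors (fullVec x m) (colVec x m k) 0).coeff N = (-1) ^ (N - k) * (κ₂ * κ₃) := by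
    rw [colVec, c1]
    simp
    ring
  have hs : ((-1 : ℝ)) ^ N = (-1) ^ k * (-1) ^ (N - k) := by
    rw [← pow_add, Nat.add_sub_cancel' hk]
  have hs2 : ((-1 : ℝ)) ^ k * (-1) ^ k = 1 := by
    rw [← mul_pow]
    simp
  have hs3 : ((-1 : ℝ)) ^ (N - k) ≠ 0 := pow_ne_zero _ (by norm_num)
  have : (-1) ^ k * asymp x m k = κ₂ * κ₃ / κ₁ := by
    rw [asymp, hnum, hlead, hs]
    have hs4 : ((-1 : ℝ)) ^ k ≠ 0 := pow_ne_zero _ (by norm_num)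
    field_simp
  rw [this]
  positivity

end PeakonData

end Data

/-! ### The moment system for the second column, positivity of `τ`, and recovery of the peakons. -/

section Formulae

open Polynomial

theorem integral_spectralMeasure {N : ℕ} (ζ b : Fin N → ℝ) (hb : ∀ j, 0 < b j) (f : ℝ → ℝ) :
    ∫ y, f y ∂(spectralMeasure ζ b) = ∑ j, b j * f (ζ j) := by
  rw [spectralMeasure, integral_finsetSum_measure]
  · refine Finset.sum_congr rfl fun j _ => ?_
    rw [integral_smul_measure, integral_dirac, ENNReal.toReal_ofReal (hb j).le, smul_eq_mul]
  · intro j _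
    exact (integrable_dirac (by simp)).smul_measure ENNReal.ofReal_ne_top

theorem continuous_dslope {f : ℝ → ℝ} (hf : Differentiable ℝ f) (a : ℝ) :
    Continuous (dslope f a) := by
  rw [continuous_iff_continuousAt]
  intro z
  by_cases hz : z = a
  · subst hz
    exact continuousAt_dslope_same.2 (hf z)
  · exact (continuousAt_dslope_of_ne hz).2 (hf z).continuousAt

/-- Partial fractions only cover `z` off the spectrum; the formulae for `P_k` and `P̂_k` extend to
the eigenvalues by continuity of `dslope`. -/
theorem eq_of_eq_off_finite {N : ℕ} (ζ : Fin N → ℝ) {f g : ℝ → ℝ} (hf : Continuous f)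
    (hg : Continuous g) (h : ∀ z, (∀ j, z ≠ ζ j) → f z = g z) (z : ℝ) : f z = g z := by
  have hd : Dense (Set.range ζ)ᶜ := (Set.finite_range ζ).countable.dense_compl ℝ
  refine congrFun (hf.ext_on hd hg fun y hy => h y fun j hj => hy ⟨j, hj.symm⟩) z

namespace PeakonData

variable {N : ℕ} {x m ζ b : Fin N → ℝ}

theorem moment_eq (h : PeakonData x m ζ b) (i : ℤ) :
    moment (spectralMeasure ζ b) i = ∑ j, b j * ζ j ^ i :=
  integral_spectralMeasure ζ b h.res_pos _

theorem skewBimoment_eq (h : PeakonData x m ζ b) (i j : ℤ) :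
    skewBimoment (spectralMeasure ζ b) i j =
      ∑ p, ∑ q, b p * b q * ((ζ q - ζ p) / (ζ p + ζ q)) * ζ p ^ i * ζ q ^ j := by
  simp only [skewBimoment, integral_spectralMeasure ζ b h.res_pos, Finset.mul_sum]
  refine Finset.sum_congr rfl fun p _ => Finset.sum_congr rfl fun q _ => by ring

theorem skewArray (h : PeakonData x m ζ b) (l : ℤ) :
    SkewArray (bimomentArray (spectralMeasure ζ b) l) := by
  intro i j
  rw [bimomentArray, bimomentArray, h.skewBimoment_eq, h.skewBimoment_eq, Finset.sum_comm,
    ← Finset.sum_neg_distrib]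
  refine Finset.sum_congr rfl fun p _ => ?_
  rw [← Finset.sum_neg_distrib]
  refine Finset.sum_congr rfl fun q _ => ?_
  rw [add_comm (ζ q) (ζ p)]
  ring

/-- The coefficients of `Q_k(z) / z`. -/
def quotCoeff (x m : Fin N → ℝ) (k j : ℕ) : ℝ := -(colVec x m k 0).coeff (j + 1)

theorem hasDegree_colVec {k : ℕ} (hk : 1 ≤ k) (hkN : k ≤ N) : HasDegree k (colVec x m k) := by
  have hlen : ((pairList x m).take k).length = k := by
    rw [List.length_take, length_pairList, min_eq_left hkN]
  have := hasDegree_unitTwo ((pairList x m).take k) (by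
    intro hc
    rw [hc] at hlen
    simp at hlen
    omega)
  rwa [hlen] at this

theorem eval_colVec_zero {k : ℕ} (hk : 1 ≤ k) (hkN : k ≤ N) (z : ℝ) :
    (colVec x m k 0).eval z = -(z * ∑ j ∈ Finset.range k, quotCoeff x m k j * z ^ j) := by
  have hd := (hasDegree_colVec (x := x) (m := m) hk hkN).fst
  have h0 : (colVec x m k 0).coeff 0 = 0 := (low_coeffs_unitTwo _).1
  rw [eval_eq_sum_range' (n := k + 1) (Nat.lt_succ_of_le (natDegree_le_iff_coeff_eq_zero.2 hd)),
    Finset.sum_range_succ', h0, zero_mul, add_zero, Finset.mul_sum, ← Finset.sum_neg_distrib]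
  refine Finset.sum_congr rfl fun j _ => ?_
  rw [quotCoeff]
  ring

/-- The value of `β ⬝ r`. -/
def momentPairing (x m ζ b : Fin N → ℝ) (k : ℕ) : ℝ :=
  ∑ j ∈ Finset.range k, quotCoeff x m k j * momentSeq (spectralMeasure ζ b) 0 j

theorem sum_quotCoeff_momentSeq (h : PeakonData x m ζ b) (k : ℕ) :
    momentPairing x m ζ b k =
      ∑ l, b l * ∑ j ∈ Finset.range k, quotCoeff x m k j * ζ l ^ j := by
  simp only [momentPairing, momentSeq, h.moment_eq, Finset.mul_sum]
  rw [Finset.sum_comm]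
  refine Finset.sum_congr rfl fun l _ => Finset.sum_congr rfl fun j _ => ?_
  rw [zero_add, zpow_natCast]
  ring

theorem asymp_eq_one_sub (h : PeakonData x m ζ b) {k : ℕ} (hk : 1 ≤ k) (hkN : k ≤ N) :
    asymp x m k = 1 - momentPairing x m ζ b k := by
  rw [h.asymp_eq hkN, h.sum_quotCoeff_momentSeq, sub_eq_add_neg, ← Finset.sum_neg_distrib]
  congr 1
  refine Finset.sum_congr rfl fun l _ => ?_
  rw [eval_colVec_zero hk hkN]
  have := (h.eig_pos l).ne'
  field_simp

theorem sum_bimoment_quotCoeff (h : PeakonData x m ζ b) (k i : ℕ) :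
    ∑ j ∈ Finset.range k, bimomentArray (spectralMeasure ζ b) 0 i j * quotCoeff x m k j =
      ∑ p, ∑ q, b p * b q * ((ζ q - ζ p) / (ζ p + ζ q)) * ζ p ^ i *
        ∑ j ∈ Finset.range k, quotCoeff x m k j * ζ q ^ j := by
  simp only [bimomentArray, h.skewBimoment_eq, Finset.mul_sum, Finset.sum_mul]
  rw [Finset.sum_comm]
  refine Finset.sum_congr rfl fun p _ => ?_
  rw [Finset.sum_comm]
  refine Finset.sum_congr rfl fun q _ => Finset.sum_congr rfl fun j _ => ?_
  rw [zero_add, zero_add, zpow_natCast, zpow_natCast]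
  ring

/-- This is orthogonality after the splitting `ζ_l / (ζ_p + ζ_l) = 1/2 + (ζ_l - ζ_p) / (2 (ζ_p +
ζ_l))`, which replaces the Cauchy kernel by the skew kernel of `J` and a multiple of `β`. -/
theorem bimoment_linear_system (h : PeakonData x m ζ b) {k : ℕ} (hk : 1 ≤ k) (hkN : k ≤ N)
    {i : ℕ} (hi : i < k) :
    ∑ j ∈ Finset.range k, bimomentArray (spectralMeasure ζ b) 0 i j * quotCoeff x m k j =
      -(2 - momentPairing x m ζ b k) * momentSeq (spectralMeasure ζ b) 0 i := by
  have h1 := h.orthogonality hkN hi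
  have hS := h.sum_quotCoeff_momentSeq k
  rw [h.sum_bimoment_quotCoeff, momentSeq, h.moment_eq]
  set S := momentPairing x m ζ b k with hSdef
  set R : Fin N → ℝ := fun l => ∑ j ∈ Finset.range k, quotCoeff x m k j * ζ l ^ j with hR
  have h2 : ∀ p, b p * ζ p ^ i * (asymp x m k -
        ∑ l, b l * (colVec x m k 0).eval (ζ l) / (ζ p + ζ l)) =
      (1 - S / 2) * (b p * ζ p ^ i) +
        1 / 2 * ∑ q, b p * b q * ((ζ q - ζ p) / (ζ p + ζ q)) * ζ p ^ i * R q := by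
    intro p
    have h3 : ∑ l, b l * (colVec x m k 0).eval (ζ l) / (ζ p + ζ l) =
        -(1 / 2 * S) - 1 / 2 * ∑ q, b q * ((ζ q - ζ p) / (ζ p + ζ q)) * R q := by
      rw [hS, Finset.mul_sum, Finset.mul_sum, ← Finset.sum_neg_distrib, ← Finset.sum_sub_distrib]
      refine Finset.sum_congr rfl fun l _ => ?_
      rw [eval_colVec_zero hk hkN]
      change b l * -(ζ l * R l) / (ζ p + ζ l) =
        -(1 / 2 * (b l * R l)) - 1 / 2 * (b l * ((ζ l - ζ p) / (ζ p + ζ l)) * R l)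
      have h4 : ζ p + ζ l ≠ 0 := (add_pos (h.eig_pos p) (h.eig_pos l)).ne'
      field_simp
      ring
    have h5 : ∑ q, b p * b q * ((ζ q - ζ p) / (ζ p + ζ q)) * ζ p ^ i * R q =
        b p * ζ p ^ i * ∑ q, b q * ((ζ q - ζ p) / (ζ p + ζ q)) * R q := by
      rw [Finset.mul_sum]
      refine Finset.sum_congr rfl fun q _ => by ring
    rw [h3, h5, h.asymp_eq_one_sub hk hkN]
    ring
  rw [Finset.sum_congr rfl fun p _ => h2 p, Finset.sum_add_distrib, ← Finset.mul_sum,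
    ← Finset.mul_sum] at h1
  simp only [zero_add, zpow_natCast]
  linear_combination 2 * h1

/-- Pairing the linear system with `r` itself kills the skew side and leaves `S (2 - S) = 0`. The
sign of `1 - S` then chooses the root by the parity of `k`. -/
theorem momentPairing_eq (h : PeakonData x m ζ b) {k : ℕ} (hk : 1 ≤ k) (hkN : k ≤ N) :
    momentPairing x m ζ b k = 1 - (-1) ^ k := by
  set S := momentPairing x m ζ b k with hS
  have hskew : ∑ i ∈ Finset.range k, ∑ j ∈ Finset.range k, quotCoeff x m k i *
      (bimomentArray (spectralMeasure ζ b) 0 i j * quotCoeff x m k j) = 0 := by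
    have h1 : ∑ i ∈ Finset.range k, ∑ j ∈ Finset.range k, quotCoeff x m k i *
        (bimomentArray (spectralMeasure ζ b) 0 i j * quotCoeff x m k j) =
        -∑ i ∈ Finset.range k, ∑ j ∈ Finset.range k, quotCoeff x m k i *
        (bimomentArray (spectralMeasure ζ b) 0 i j * quotCoeff x m k j) := by
      conv_lhs => rw [Finset.sum_comm]
      rw [← Finset.sum_neg_distrib]
      refine Finset.sum_congr rfl fun i _ => ?_
      rw [← Finset.sum_neg_distrib]
      refine Finset.sum_congr rfl fun j _ => ?_
      rw [h.skewArray 0 i j]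
      ring
    linarith
  have h2 : S * (2 - S) = 0 := by
    have h3 : ∀ i ∈ Finset.range k, ∑ j ∈ Finset.range k, quotCoeff x m k i *
        (bimomentArray (spectralMeasure ζ b) 0 i j * quotCoeff x m k j) =
        -(2 - S) * (quotCoeff x m k i * momentSeq (spectralMeasure ζ b) 0 i) := by
      intro i hi
      rw [← Finset.mul_sum, h.bimoment_linear_system hk hkN (Finset.mem_range.1 hi)]
      ring
    rw [Finset.sum_congr rfl h3, ← Finset.mul_sum] at hskew
    have h4 : ∑ i ∈ Finset.range k, quotCoeff x m k i * momentSeq (spectralMeasure ζ b) 0 i = S :=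
      rfl
    rw [h4] at hskew
    linear_combination -hskew
  have hsign := h.asymp_sign hkN
  rw [h.asymp_eq_one_sub hk hkN, ← hS] at hsign
  rcases Nat.even_or_odd k with he | ho
  · rw [he.neg_one_pow] at hsign ⊢
    rcases mul_eq_zero.1 h2 with h3 | h3
    · linarith
    · linarith
  · rw [ho.neg_one_pow] at hsign ⊢
    rcases mul_eq_zero.1 h2 with h3 | h3
    · linarith
    · linarith

theorem quotCoeff_last_sign (h : PeakonData x m ζ b) {k : ℕ} (hk : 1 ≤ k) (hkN : k ≤ N) :
    0 < (-1) ^ (k - 1) * quotCoeff x m k (k - 1) := by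
  have hlt : k - 1 < (pairList x m).length := by
    rw [length_pairList]
    omega
  have htake : (pairList x m).take k =
      (pairList x m).take (k - 1) ++ [(pairList x m)[k - 1]] := by
    rw [← List.take_succ_eq_append_getElem hlt, Nat.sub_add_cancel hk]
  have hpw := pairwise_pairList h.strictMono_pos h.mass_pos
  rw [← List.take_append_drop k (pairList x m), List.pairwise_append, htake] at hpw
  have := leading_polyChain_unitTwo _ _ hpw.1 fun e he =>
    (pairList_pos (x := x) h.mass_pos e (List.mem_of_mem_take (htake ▸ he))).1
  rw [← htake, List.length_take, length_pairList, min_eq_left (by omega)] at this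
  rw [quotCoeff, colVec]
  rw [pow_succ] at this
  linarith

theorem quotCoeff_zero (k : ℕ) :
    quotCoeff x m k 0 = 2 * (((pairList x m).take k).map Prod.snd).sum := by
  rw [quotCoeff, zero_add, colVec, (low_coeffs_unitTwo _).2.1]
  ring

theorem eval_colVec_two_zero (k : ℕ) :
    (colVec x m k 2).eval 0 = 2 * (((pairList x m).take k).map Prod.fst).sum := by
  rw [← coeff_zero_eq_eval_zero, colVec, (low_coeffs_unitTwo _).2.2.2]

/-- At `z = 0` the double Cauchy sum for `u_2` is expressed by moments of index `-1`, through `2 /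
(p + q) = 1 / p - (q - p) / (p (p + q))`. -/
theorem shifted_sum (h : PeakonData x m ζ b) {k : ℕ} (hk : 1 ≤ k) (hkN : k ≤ N) :
    (colVec x m k 2).eval 0 =
      momentSeq (spectralMeasure ζ b) (-1) 0 * momentPairing x m ζ b k -
        ∑ j ∈ Finset.range k,
          quotCoeff x m k j * bimomentArray (spectralMeasure ζ b) (-1) 0 (j + 1) := by
  have h0 : (colVec x m k 0).eval 0 = 0 := by
    rw [eval_colVec_zero hk hkN]
    simp
  rw [h.eval_colVec_two hkN fun j => (h.eig_pos j).ne, h.sum_quotCoeff_momentSeq, momentSeq,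
    h.moment_eq]
  set R : Fin N → ℝ := fun l => ∑ j ∈ Finset.range k, quotCoeff x m k j * ζ l ^ j with hR
  have h1 : ∑ j ∈ Finset.range k,
      quotCoeff x m k j * bimomentArray (spectralMeasure ζ b) (-1) 0 (j + 1) =
      ∑ p, ∑ q, b p * b q * ((ζ q - ζ p) / (ζ p + ζ q)) * (ζ p)⁻¹ * R q := by
    simp only [bimomentArray, h.skewBimoment_eq, Finset.mul_sum, hR]
    rw [Finset.sum_comm]
    refine Finset.sum_congr rfl fun p _ => ?_
    rw [Finset.sum_comm]
    refine Finset.sum_congr rfl fun q _ => Finset.sum_congr rfl fun j _ => ?_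
    have e1 : (-1 : ℤ) + ((0 : ℕ) : ℤ) = -1 := by norm_num
    have e2 : (-1 : ℤ) + ((j + 1 : ℕ) : ℤ) = (j : ℤ) := by push_cast; ring
    rw [e1, e2, zpow_neg_one, zpow_natCast]
    ring
  rw [Finset.sum_comm] at h1
  rw [h1, h0, Finset.mul_sum, Finset.mul_sum, ← Finset.sum_sub_distrib]
  refine Finset.sum_congr rfl fun q _ => ?_
  rw [Finset.sum_mul, ← Finset.sum_sub_distrib, eval_colVec_zero hk hkN, cauchySum,
    Finset.mul_sum, Finset.sum_mul, Finset.mul_sum]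
  refine Finset.sum_congr rfl fun p _ => ?_
  change 2 * (b q * (b p / (ζ q + ζ p)) * ((-(ζ q * R q) - 0) / (0 - ζ q))) = _
  have e1 : (-1 : ℤ) + ((0 : ℕ) : ℤ) = -1 := by norm_num
  rw [e1, zpow_neg_one, add_comm (ζ q)]
  have h4 : ζ p + ζ q ≠ 0 := (add_pos (h.eig_pos p) (h.eig_pos q)).ne'
  have h5 := (h.eig_pos p).ne'
  have h6 := (h.eig_pos q).ne'
  change _ = b p * (ζ p)⁻¹ * (b q * R q) - b p * b q * ((ζ q - ζ p) / (ζ p + ζ q)) * (ζ p)⁻¹ * R q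
  rw [sub_zero, zero_sub]
  field_simp
  ring

/-- The relations of the Pfaffians with the coefficients of `Q_k`. -/
theorem pfaffian_relations (h : PeakonData x m ζ b) {k : ℕ} (hk : 1 ≤ k) (hkN : k ≤ N) :
    tau (spectralMeasure ζ b) 0 (k : ℤ) * quotCoeff x m k (k - 1) =
      (-1) ^ (k - 1) * 2 * tau (spectralMeasure ζ b) 0 ((k - 1 : ℕ) : ℤ) ∧
    tau (spectralMeasure ζ b) 0 (k : ℤ) * quotCoeff x m k 0 =
      2 * tau (spectralMeasure ζ b) 1 ((k - 1 : ℕ) : ℤ) ∧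
    (tau (spectralMeasure ζ b) 0 (k : ℤ) ≠ 0 → ∀ z, polyQ (spectralMeasure ζ b) k z =
      -(colVec x m k 0).eval z) ∧
    tau (spectralMeasure ζ b) 0 (k : ℤ) * (colVec x m k 2).eval 0 =
      2 * (momentSeq (spectralMeasure ζ b) (-1) 0 * tau (spectralMeasure ζ b) 0 (k : ℤ) -
        tau (spectralMeasure ζ b) (-1) ((k + 1 : ℕ) : ℤ)) := by
  have hJ := h.skewArray 0
  have hJ' := h.skewArray (-1)
  have hS := h.momentPairing_eq hk hkN
  have hshift := h.shifted_sum hk hkN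
  have hQ := eval_colVec_zero (x := x) (m := m) hk hkN
  have hsys : ∀ i < k, _ := fun i hi => h.bimoment_linear_system hk hkN hi
  rw [hS] at hshift hsys
  rw [momentPairing] at hS
  rcases Nat.even_or_odd k with ⟨n, rfl⟩ | ⟨n, rfl⟩
  · have hn : 0 < n := by omega
    rw [← two_mul] at *
    rw [(even_two_mul n).neg_one_pow] at hS hshift hsys
    have hβ : ∑ j ∈ Finset.range (2 * n), quotCoeff x m (2 * n) j *
      momentSeq (spectralMeasure ζ b) 0 j = 0 := by rw [hS]; ring
    have hr : ∀ i < 2 * n, ∑ j ∈ Finset.range (2 * n),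
        bimomentArray (spectralMeasure ζ b) 0 i j * quotCoeff x m (2 * n) j =
          -2 * momentSeq (spectralMeasure ζ b) 0 i := fun i hi => by
      rw [hsys i hi]
      ring
    refine ⟨?_, even_first_coeff hn hJ hr hβ, fun hτ z => ?_, ?_⟩
    · rw [even_last_coeff hn hJ hr hβ,
        Odd.neg_one_pow (Nat.Even.sub_odd (by omega) (even_two_mul n) odd_one)]
      ring
    · rw [even_polyQ hJ hr hβ hτ, hQ, neg_neg]
    · have := even_shifted hJ hJ' hr hβ
      rw [hshift]
      linear_combination -this
  · rw [(odd_two_mul_add_one n).neg_one_pow] at hS hshift hsys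
    have hβ : ∑ j ∈ Finset.range (2 * n + 1), quotCoeff x m (2 * n + 1) j *
      momentSeq (spectralMeasure ζ b) 0 j = 2 := by rw [hS]; ring
    have hr : ∀ i < 2 * n + 1, ∑ j ∈ Finset.range (2 * n + 1),
        bimomentArray (spectralMeasure ζ b) 0 i j * quotCoeff x m (2 * n + 1) j = 0 :=
      fun i hi => by
        rw [hsys i hi]
        ring
    refine ⟨?_, odd_first_coeff hJ hr hβ, fun hτ z => ?_, ?_⟩
    · rw [Nat.add_sub_cancel, odd_last_coeff hJ hr hβ, (even_two_mul n).neg_one_pow]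
      ring
    · rw [odd_polyQ hJ hr hβ hτ, hQ, neg_neg]
    · have := odd_shifted hJ hJ' hr hβ
      rw [hshift]
      linear_combination -this

/-- The relation for the top coefficient says that `τ_{k+1}` times a positive number is `2 τ_k`; no
positivity of the kernel is used. -/
theorem tau_pos (h : PeakonData x m ζ b) {k : ℕ} (hkN : k ≤ N) :
    0 < tau (spectralMeasure ζ b) 0 (k : ℤ) := by
  induction k with
  | zero =>
    have : tau (spectralMeasure ζ b) 0 ((2 * 0 : ℕ) : ℤ) = 1 := by
      rw [tau_even, pfNat, pfaffian_eq]
      simp [IsOrderedMatching, pfTerm, Subsingleton.strictMono]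
    simp only [mul_zero] at this
    rw [this]
    exact one_pos
  | succ k ih =>
    have h1 := (h.pfaffian_relations (Nat.le_add_left 1 k) hkN).1
    have h2 := h.quotCoeff_last_sign (Nat.le_add_left 1 k) hkN
    rw [Nat.add_sub_cancel] at h1 h2
    have h3 := ih (by omega)
    have h4 : ((-1 : ℝ)) ^ k * (-1) ^ k = 1 := by
      rw [← mul_pow]
      simp
    have h5 : tau (spectralMeasure ζ b) 0 ((k + 1 : ℕ) : ℤ) *
        ((-1) ^ k * quotCoeff x m (k + 1) k) = 2 * tau (spectralMeasure ζ b) 0 (k : ℤ) := by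
      linear_combination (-1) ^ k * h1 + 2 * tau (spectralMeasure ζ b) 0 (k : ℤ) * h4
    have h6 : 0 < tau (spectralMeasure ζ b) 0 ((k + 1 : ℕ) : ℤ) *
        ((-1) ^ k * quotCoeff x m (k + 1) k) := by
      rw [h5]
      positivity
    exact (pos_iff_pos_of_mul_pos h6).2 h2

theorem polyQ_eq (h : PeakonData x m ζ b) {k : ℕ} (hk : 1 ≤ k) (hkN : k ≤ N) :
    polyQ (spectralMeasure ζ b) k = fun z => -(colVec x m k 0).eval z :=
  funext ((h.pfaffian_relations hk hkN).2.2.1 (h.tau_pos hkN).ne')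

theorem dslope_polyQ (h : PeakonData x m ζ b) {k : ℕ} (hk : 1 ≤ k) (hkN : k ≤ N) {z : ℝ}
    (hz : ∀ j, z ≠ ζ j) (l : Fin N) :
    dslope (polyQ (spectralMeasure ζ b) k) (ζ l) z =
      ((colVec x m k 0).eval (ζ l) - (colVec x m k 0).eval z) / (z - ζ l) := by
  rw [dslope_of_ne _ (hz l), slope_def_field, h.polyQ_eq hk hkN]
  ring

theorem continuous_dslope_polyQ (h : PeakonData x m ζ b) {k : ℕ} (hk : 1 ≤ k) (hkN : k ≤ N)
    (a : ℝ) : Continuous (dslope (polyQ (spectralMeasure ζ b) k) a) := by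
  rw [h.polyQ_eq hk hkN]
  exact continuous_dslope (colVec x m k 0).differentiable.neg a

theorem polyP_eq (h : PeakonData x m ζ b) {k : ℕ} (hk : 1 ≤ k) (hkN : k ≤ N) (z : ℝ) :
    polyP (spectralMeasure ζ b) k z = (colVec x m k 1).eval z := by
  have hform : ∀ z, polyP (spectralMeasure ζ b) k z = (∑ l, b l *
      dslope (polyQ (spectralMeasure ζ b) k) (ζ l) z) -
      (∑ l, b l * (polyQ (spectralMeasure ζ b) k (ζ l) / ζ l)) + 1 := by
    intro z
    rw [polyP, integral_spectralMeasure ζ b h.res_pos, integral_spectralMeasure ζ b h.res_pos]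
  refine eq_of_eq_off_finite ζ (f := polyP (spectralMeasure ζ b) k) ?_ (colVec x m k 1).continuous (fun z hz => ?_) z
  · rw [funext hform]
    have := fun l => h.continuous_dslope_polyQ hk hkN (ζ l)
    fun_prop
  · rw [hform, h.eval_colVec_one hkN hz, h.asymp_eq hkN]
    simp only [h.dslope_polyQ hk hkN hz]
    rw [h.polyQ_eq hk hkN]
    simp only [neg_div, mul_neg, Finset.sum_neg_distrib, mul_div_assoc]
    ring

theorem polyPHat_eq (h : PeakonData x m ζ b) {k : ℕ} (hk : 1 ≤ k) (hkN : k ≤ N) (z : ℝ) :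
    2 * polyPHat (spectralMeasure ζ b) k z = (colVec x m k 2).eval z := by
  have hform : ∀ z, polyPHat (spectralMeasure ζ b) k z = ∑ l, b l * ∑ i, b i *
      (dslope (polyQ (spectralMeasure ζ b) k) (ζ l) z / (ζ l + ζ i)) := by
    intro z
    simp only [polyPHat, integral_spectralMeasure ζ b h.res_pos]
  refine eq_of_eq_off_finite ζ (f := fun z => 2 * polyPHat (spectralMeasure ζ b) k z) ?_
    (colVec x m k 2).continuous (fun z hz => ?_) z
  · simp only [hform]
    have := fun l => h.continuous_dslope_polyQ hk hkN (ζ l)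
    fun_prop
  · rw [hform, h.eval_colVec_two hkN hz]
    simp only [h.dslope_polyQ hk hkN hz]
    congr 1
    refine Finset.sum_congr rfl fun l _ => ?_
    rw [cauchySum, Finset.mul_sum, Finset.mul_sum, Finset.sum_mul]
    refine Finset.sum_congr rfl fun i _ => by ring

theorem col_eq (h : PeakonData x m ζ b) {k : ℕ} (hk : 1 ≤ k) (hkN : k ≤ N) (z : ℝ) :
    (partialTransition x m k z).col 1 =
      ![-polyQ (spectralMeasure ζ b) k z, polyP (spectralMeasure ζ b) k z,
        2 * polyPHat (spectralMeasure ζ b) k z] := by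
  rw [partialTransition_col, h.polyQ_eq hk hkN, h.polyP_eq hk hkN, h.polyPHat_eq hk hkN]
  funext i
  fin_cases i <;> simp [colVec]

theorem sum_snd (h : PeakonData x m ζ b) {k : ℕ} (hkN : k ≤ N) :
    (((pairList x m).take k).map Prod.snd).sum =
      tau (spectralMeasure ζ b) 1 ((k : ℤ) - 1) / tau (spectralMeasure ζ b) 0 k := by
  rcases k with _ | k
  -- For `k = 0` the empty sum agrees with the convention `τ_{-1}^{(1)} = 0`.
  · simp [tau]
  · have h1 := (h.pfaffian_relations (Nat.le_add_left 1 k) hkN).2.1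
    rw [quotCoeff_zero, Nat.add_sub_cancel] at h1
    rw [eq_div_iff (h.tau_pos hkN).ne']
    have : (((k + 1 : ℕ) : ℤ)) - 1 = (k : ℤ) := by push_cast; ring
    rw [this]
    linear_combination h1 / 2

theorem sum_fst (h : PeakonData x m ζ b) {k : ℕ} (hkN : k ≤ N) :
    (((pairList x m).take k).map Prod.fst).sum = momentSeq (spectralMeasure ζ b) (-1) 0 -
      tau (spectralMeasure ζ b) (-1) ((k : ℤ) + 1) / tau (spectralMeasure ζ b) 0 k := by
  have hτ := (h.tau_pos hkN).ne'
  rcases k with _ | k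
  -- For `k = 0` both sides vanish because `τ_1^{(-1)} = β_{-1}` and `τ_0 = 1`; this lets the
  -- difference formula start at `k = 1`.
  · have h1 := tau_odd (spectralMeasure ζ b) (-1) 0
    have h0 := tau_even (spectralMeasure ζ b) 0 0
    have e0 : pfNat 0 (bimomentArray (spectralMeasure ζ b) 0) = 1 := by
      rw [pfNat, pfaffian_eq]
      simp [IsOrderedMatching, pfTerm, Subsingleton.strictMono]
    have e1 : pfNat (0 + 1) (borderFirst (bimomentArray (spectralMeasure ζ b) (-1))
        (momentSeq (spectralMeasure ζ b) (-1))) = momentSeq (spectralMeasure ζ b) (-1) 0 := by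
      rw [pfNat_borderFirst (h.skewArray (-1))]
      have hj : ∀ w : ℕ → ℝ, pfNat (0 + 1) (border (bimomentArray (spectralMeasure ζ b) (-1)) w
          (2 * 0 + 1)) = w 0 := by
        intro w
        have := pfNat_border_mul (n := 0) (h.skewArray (-1)) (fun _ => 1) w (fun _ => 1) (by
          intro i hi
          have := h.skewArray (-1) 0 0
          simp at hi
          simp [hi]
          linarith)
        rw [pfNat_border_unit _ (fun _ => 1) rfl (by simp)] at this
        have e2 : pfNat 0 (bimomentArray (spectralMeasure ζ b) (-1)) = 1 := by
          rw [pfNat, pfaffian_eq]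
          simp [IsOrderedMatching, pfTerm, Subsingleton.strictMono]
        rw [e2] at this
        simpa using this
      exact hj _
    rw [e1] at h1
    rw [e0] at h0
    simp at h1 h0
    simp [h1, h0]
  · have h1 := (h.pfaffian_relations (Nat.le_add_left 1 k) hkN).2.2.2
    rw [eval_colVec_two_zero] at h1
    push_cast at h1 hτ ⊢
    field_simp
    linear_combination h1 / 2

theorem sum_take_succ {x m : Fin N → ℝ} {k : ℕ} (hk : 1 ≤ k) (hkN : k ≤ N) {i : Fin N}
    (hi : (i : ℕ) = N - k)
    (f : ℝ × ℝ → ℝ) :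
    (((pairList x m).take k).map f).sum = (((pairList x m).take (k - 1)).map f).sum +
      f (m i * Real.exp (x i),
        m i * Real.exp (-x i)) := by
  have hlt : k - 1 < (pairList x m).length := by
    rw [length_pairList]
    omega
  have htake : (pairList x m).take k =
      (pairList x m).take (k - 1) ++ [(pairList x m)[k - 1]] := by
    rw [← List.take_succ_eq_append_getElem hlt, Nat.sub_add_cancel hk]
  have hrev : Fin.rev (⟨k - 1, by omega⟩ : Fin N) = i := by
    ext
    simp
    omega
  have hg : (pairList x m)[k - 1] =
      (m i * Real.exp (x i),
        m i * Real.exp (-x i)) := by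
    simp only [pairList, List.getElem_ofFn, hrev]
  rw [htake, hg]
  simp

theorem pfaffian_formulae (h : PeakonData x m ζ b) {k : ℕ} (hk : 1 ≤ k) (hkN : k ≤ N)
    {i : Fin N} (hi : (i : ℕ) = N - k) :
    m i * Real.exp (-x i) =
        tau (spectralMeasure ζ b) 1 (k - 1) / tau (spectralMeasure ζ b) 0 k -
        tau (spectralMeasure ζ b) 1 (k - 2) / tau (spectralMeasure ζ b) 0 (k - 1) ∧
      m i * Real.exp (x i) =
        tau (spectralMeasure ζ b) (-1) k / tau (spectralMeasure ζ b) 0 (k - 1) -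
        tau (spectralMeasure ζ b) (-1) (k + 1) / tau (spectralMeasure ζ b) 0 k := by
  have e1 : (((k - 1 : ℕ) : ℤ)) = (k : ℤ) - 1 := by omega
  have hk1 : k - 1 ≤ N := by omega
  constructor
  · have h1 := sum_take_succ (x := x) (m := m) hk hkN hi Prod.snd
    rw [h.sum_snd hkN, h.sum_snd hk1, e1, show (k : ℤ) - 1 - 1 = k - 2 by ring] at h1
    linarith
  · have h1 := sum_take_succ (x := x) (m := m) hk hkN hi Prod.fst
    rw [h.sum_fst hkN, h.sum_fst hk1, e1, sub_add_cancel] at h1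
    linarith

theorem unique (h : PeakonData x m ζ b) {x' m' : Fin N → ℝ} (h' : PeakonData x' m' ζ b) :
    x' = x ∧ m' = m := by
  have key : ∀ i : Fin N, x' i = x i ∧ m' i = m i := by
    intro i
    have hi : (i : ℕ) = N - (N - i) := by omega
    obtain ⟨a1, a2⟩ := h.pfaffian_formulae (k := N - i) (by omega) (by omega) hi
    obtain ⟨b1, b2⟩ := h'.pfaffian_formulae (k := N - i) (by omega) (by omega) hi
    rw [← a1] at b1
    rw [← a2] at b2
    have hxx : Real.exp (x i) * Real.exp (-x i) = 1 := by rw [← Real.exp_add]; simp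
    have hxx' : Real.exp (x' i) * Real.exp (-x' i) = 1 := by rw [← Real.exp_add]; simp
    -- The exponentials cancel in the product of `m e^{-x}` and `m e^x`.
    have hsq : m' i ^ 2 = m i ^ 2 := by
      have e : m' i * Real.exp (-x' i) * (m' i * Real.exp (x' i)) =
        m i * Real.exp (-x i) * (m i * Real.exp (x i)) := by rw [b1, b2]
      linear_combination e - m' i ^ 2 * hxx' + m i ^ 2 * hxx
    have hm : m' i = m i :=
      (sq_eq_sq₀ (h'.mass_pos i).le (h.mass_pos i).le).1 hsq
    rw [hm] at b2
    exact ⟨Real.exp_injective (mul_left_cancel₀ (h.mass_pos i).ne' b2), hm⟩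
  exact ⟨funext fun i => (key i).1, funext fun i => (key i).2⟩

end PeakonData

end Formulae

end NovikovPeakon

end

theorem mainTheorem6 (N : ℕ) (x m ζ b : Fin N → ℝ)
    (hx : StrictMono x) (hm : ∀ k, 0 < m k)
    (hζ : StrictMono ζ) (hζ_pos : ∀ j, 0 < ζ j) (hb : ∀ j, 0 < b j)
    (hdata : NovikovPeakon.IsSpectralData x m ζ b) :
    -- all the denominators below are nonzero
    (∀ k : ℕ, k ≤ N → 0 < NovikovPeakon.tau (NovikovPeakon.spectralMeasure ζ b) 0 k) ∧
    -- the second column of the partial transition matrices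
    (∀ k : ℕ, 1 ≤ k → k ≤ N → ∀ z : ℝ,
      (NovikovPeakon.partialTransition x m k z).col 1 =
        ![-NovikovPeakon.polyQ (NovikovPeakon.spectralMeasure ζ b) k z,
          NovikovPeakon.polyP (NovikovPeakon.spectralMeasure ζ b) k z,
          2 * NovikovPeakon.polyPHat (NovikovPeakon.spectralMeasure ζ b) k z]) ∧
    -- the Pfaffian formulae; the peakon number `N - k + 1` has the index `N - k` in `Fin N`
    (∀ (k : ℕ) (hk : 1 ≤ k) (hkN : k ≤ N),
      m ⟨N - k, by omega⟩ * Real.exp (-x ⟨N - k, by omega⟩) =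
        NovikovPeakon.tau (NovikovPeakon.spectralMeasure ζ b) 1 (k - 1) /
          NovikovPeakon.tau (NovikovPeakon.spectralMeasure ζ b) 0 k -
        NovikovPeakon.tau (NovikovPeakon.spectralMeasure ζ b) 1 (k - 2) /
          NovikovPeakon.tau (NovikovPeakon.spectralMeasure ζ b) 0 (k - 1) ∧
      m ⟨N - k, by omega⟩ * Real.exp (x ⟨N - k, by omega⟩) =
        NovikovPeakon.tau (NovikovPeakon.spectralMeasure ζ b) (-1) k /
          NovikovPeakon.tau (NovikovPeakon.spectralMeasure ζ b) 0 (k - 1) -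
        NovikovPeakon.tau (NovikovPeakon.spectralMeasure ζ b) (-1) (k + 1) /
          NovikovPeakon.tau (NovikovPeakon.spectralMeasure ζ b) 0 k) ∧
    -- uniqueness
    (∀ x' m' : Fin N → ℝ, StrictMono x' → (∀ k, 0 < m' k) →
      NovikovPeakon.IsSpectralData x' m' ζ b → x' = x ∧ m' = m) := by
  have h : NovikovPeakon.PeakonData x m ζ b := ⟨hx, hm, hζ, hζ_pos, hb, hdata⟩
  exact ⟨fun k hk => h.tau_pos hk, fun k hk hkN z => h.col_eq hk hkN z,
    fun k hk hkN => h.pfaffian_formulae hk hkN rfl,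
    fun x' m' hx' hm' hdata' => h.unique ⟨hx', hm', hζ, hζ_pos, hb, hdata'⟩⟩
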